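/- Let $X$ be a real Banach space, let $r\ge 1$, and let $D\subseteq X^*$ be a nonempty $r$-norming set, i.e. $\|x\|\le r\,\sup\{|\varphi(x)|/\|\varphi\| : \varphi\in D\setminus\{0\}\}$ for every $x\in X$ (the supremum of the empty set being $0$). The following are equivalent. (a) $X$ has an $r$-projectional skeleton $\mathfrak s$ with $D\subseteq D(\mathfrak s)$. (b) $D$ generates projections in $X$. Here an *$r$-projectional skeleton* in $X$ is a family $\mathfrak s=\{P_s\}_{s\in\Gamma}$ of bounded linear projections $P_s\colon X\to X$ with $\|P_s\|\le r$, indexed by a directed partially ordered set $\Gamma$, such that: (1) $X=\bigcup_{s\in\Gamma}P_sX$ and each $P_sX$ is separable; (2) $P_s=P_s\circ P_t=P_t\circ P_s$ whenever $s\le t$; (3) every sequence $s_0<s_1<\cdots$ in $\Gamma$ has a least upper bound $t$ in $\Gamma$, and $P_tX=\operatorname{cl}\big(\bigcup_n P_{s_n}X\big)$. Its induced subspace is $D(\mathfrak s)=\bigcup_{s\in\Gamma}P_s^*X^*$. For a cardinal $\theta$, $H(\theta)$ is the set of all sets whose transitive closure has cardinality less than $\theta$. The set $D$ *generates projections in $X$*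 if there is a cardinal $\theta_0$ such that for every regular cardinal $\theta\ge\theta_0$ and every countable elementary substructure $M$ of $(H(\theta),\in)$ with $D\in M$, the set $\operatorname{cl}(X\cap M)$ is a linear subspace of $X$ and $X=\operatorname{cl}(X\cap M)\oplus{}^\perp(D\cap M)$, where ${}^\perp B=\{x\in X:\varphi(x)=0\text{ for all }\varphi\in B\}$. The points of $X$ may be any sets; functionals are sets of ordered pairs, and real numbers are Dedekind cuts. -/

import Mathlib

universe u

/-! ### Banach spaces: norming sets and annihilators -/

/-- The function `|x| = sup {|φ x| / ‖φ‖ : φ ∈ D, φ ≠ 0}`. The family is bounded by `‖x‖`. -/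
noncomputable def normingNorm {X : Type u} [NormedAddCommGroup X] [NormedSpace ℝ X]
    (D : Set (StrongDual ℝ X)) (x : X) : ℝ :=
  ⨆ φ : {φ : StrongDual ℝ X // φ ∈ D ∧ φ ≠ 0}, |φ.1 x| / ‖φ.1‖

/-- `D` is `r`-norming: `‖x‖ ≤ r * |x|` for all `x`. As `|x| ≤ ‖x‖` always holds, `|·|` is then an
equivalent norm. -/
def IsNorming {X : Type u} [NormedAddCommGroup X] [NormedSpace ℝ X]
    (r : ℝ) (D : Set (StrongDual ℝ X)) : Prop :=
  ∀ x : X, ‖x‖ ≤ r * normingNorm D x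

/-- The annihilator `⊥B = {x ∈ X : φ x = 0 for all φ ∈ B}` of a set `B` of functionals. -/
def leftAnnihilator {X : Type u} [NormedAddCommGroup X] [NormedSpace ℝ X]
    (B : Set (StrongDual ℝ X)) : Submodule ℝ X where
  carrier := {x | ∀ φ ∈ B, φ x = 0}
  add_mem' := by
    intro x y hx hy φ hφ
    rw [map_add, hx φ hφ, hy φ hφ, add_zero]
  zero_mem' := fun φ _ => map_zero φ
  smul_mem' := by
    intro c x hx φ hφ
    rw [map_smul, hx φ hφ, smul_zero]

/-! ### Projectional skeletons -/

/-- A projectional skeleton `(P s)_{s ∈ Γ}` in `X`. -/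
structure ProjectionalSkeleton (X : Type u) [NormedAddCommGroup X] [NormedSpace ℝ X]
    (Γ : Type u) [PartialOrder Γ] where
  /-- The operators of the skeleton. -/
  P : Γ → X →L[ℝ] X
  /-- Each operator is a projection. -/
  proj : ∀ s, (P s).comp (P s) = P s
  /-- The index set is directed. -/
  directed : ∀ s₀ s₁ : Γ, ∃ t, s₀ ≤ t ∧ s₁ ≤ t
  /-- The ranges cover the space. -/
  cover : (⋃ s, Set.range (P s)) = Set.univ
  /-- The ranges are separable. -/
  separable : ∀ s, TopologicalSpace.IsSeparable (Set.range (P s))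
  comp_right : ∀ s t, s ≤ t → (P s).comp (P t) = P s
  comp_left : ∀ s t, s ≤ t → (P t).comp (P s) = P s
  /-- Strictly increasing sequences have suprema, and the projections are continuous there. -/
  sup_seq : ∀ s : ℕ → Γ, StrictMono s →
    ∃ t, IsLUB (Set.range s) t ∧ Set.range (P t) = closure (⋃ n, Set.range (P (s n)))

/-- An `r`-projectional skeleton: all projections have norm at most `r`. -/
def ProjectionalSkeleton.BoundedBy {X : Type u} [NormedAddCommGroup X] [NormedSpace ℝ X]
    {Γ : Type u} [PartialOrder Γ] (s : ProjectionalSkeleton X Γ) (r : ℝ) : Prop :=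
  ∀ i, ‖s.P i‖ ≤ r

/-- The subspace `D(s) = ⋃ₛ Pₛ* X*` of the dual induced by a skeleton; `Pₛ* φ = φ ∘ Pₛ`. -/
def ProjectionalSkeleton.dualSpace {X : Type u} [NormedAddCommGroup X] [NormedSpace ℝ X]
    {Γ : Type u} [PartialOrder Γ] (s : ProjectionalSkeleton X Γ) : Set (StrongDual ℝ X) :=
  ⋃ i, Set.range fun φ : StrongDual ℝ X => φ.comp (s.P i)

/-! ### The structures `(H(θ), ∈)` and their elementary substructures -/

/-- The only symbol of the language of set theory: the binary relation symbol `∈`. -/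
inductive SetTheoryRel : ℕ → Type
  | mem : SetTheoryRel 2

/-- The first-order language of set theory. -/
def setLanguage : FirstOrder.Language.{0, 0} := ⟨fun _ => Empty, SetTheoryRel⟩

/-- Every collection `N` of ZFC sets is a structure `(N, ∈)`. -/
instance setStructure (N : Set ZFSet.{u}) : setLanguage.Structure N where
  funMap := fun f => Empty.elim f
  RelMap := fun {_} R =>
    match R with
    | SetTheoryRel.mem => fun v => (v 0 : ZFSet.{u}) ∈ (v 1 : ZFSet.{u})

/-- The transitive closure of a set `x`: all `y` with `y ∈ x₀ ∈ ⋯ ∈ xₖ ∈ x` (or `y ∈ x`). -/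
def transClosure (x : ZFSet.{u}) : Set ZFSet.{u} :=
  {y | Relation.TransGen (fun a b : ZFSet.{u} => a ∈ b) y x}

/-- `H(θ)`: the sets whose transitive closure has cardinality less than `θ`. -/
def hereditary (θ : Cardinal.{u}) : Set ZFSet.{u} :=
  {x | Cardinal.mk (transClosure x) < Cardinal.lift.{u + 1} θ}

/-- The collection of ZFC sets that are elements of an elementary substructure of `H(θ)`. -/
def elements {θ : Cardinal.{u}} (M : setLanguage.ElementarySubstructure (hereditary θ)) :
    Set ZFSet.{u} :=
  Subtype.val '' (M : Set (hereditary θ))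

/-! ### Reals, functionals and sets of functionals as ZFC sets -/

/-- A natural number as a von Neumann ordinal. -/
noncomputable def natCode (n : ℕ) : ZFSet.{u} := (n : Ordinal.{u}).toZFSet

/-- A real number as a Dedekind cut: the set of all fractions `(a - b) / (c + 1)` below `r`, where
a fraction is the triple `((a, b), c)` of natural numbers. -/
noncomputable def realCode (r : ℝ) : ZFSet.{u} :=
  ZFSet.range fun p : {p : (ℕ × ℕ) × ℕ // ((p.1.1 : ℝ) - p.1.2) / (p.2 + 1) < r} =>
    ZFSet.pair (ZFSet.pair (natCode p.1.1.1) (natCode p.1.1.2)) (natCode p.1.2)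

/-- A functional on `X` as a set of ordered pairs, where `e` realizes the points of `X` as sets. -/
noncomputable def functionalCode {X : Type u} [NormedAddCommGroup X] [NormedSpace ℝ X]
    (e : X ↪ ZFSet.{u}) (φ : StrongDual ℝ X) : ZFSet.{u} :=
  ZFSet.range fun x : X => ZFSet.pair (e x) (realCode (φ x))

/-- A set of functionals as a ZFC set. -/
noncomputable def dualSetCode {X : Type u} [NormedAddCommGroup X] [NormedSpace ℝ X]
    (e : X ↪ ZFSet.{u}) (D : Set (StrongDual ℝ X)) : ZFSet.{u} :=
  ZFSet.range fun φ : D => functionalCode e φ.1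

/-! ### Generating projections -/

/-- `D` generates projections in `X`, the space whose points are the sets `e x`: for every big
enough regular `θ` and every countable `M ≼ H(θ)` with `D ∈ M`, the set `cl(X ∩ M)` is a linear
subspace and `X = cl(X ∩ M) ⊕ ⊥(D ∩ M)`. -/
def GeneratesProjections {X : Type u} [NormedAddCommGroup X] [NormedSpace ℝ X]
    (e : X ↪ ZFSet.{u}) (D : Set (StrongDual ℝ X)) : Prop :=
  ∃ θ₀ : Cardinal.{u}, ∀ θ : Cardinal.{u}, θ₀ ≤ θ → θ.IsRegular →
    ∀ M : setLanguage.ElementarySubstructure (hereditary θ),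
      (M : Set (hereditary θ)).Countable → dualSetCode e D ∈ elements M →
        ∃ Y : Submodule ℝ X, (Y : Set X) = closure {x | e x ∈ elements M} ∧
          IsCompl Y (leftAnnihilator {φ | φ ∈ D ∧ functionalCode e φ ∈ elements M})

/-! From (a) to (b). For a nonempty directed set `T` of indices of a bounded skeleton, the net `P i
x`, `i ∈ T`, converges for every `x` (`ProjectionalSkeleton.exists_limit`): otherwise some
increasing sequence of indices has jumps of a fixed size, against the behaviour of the skeleton at
its supremum. Suppose that a set of points is dense in the union of the ranges over `T`, that every
functional of a set `B` satisfies `φ ∘ P i = φ` for some `i ∈ T`, and that `B` norms these points.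
Then the limit of `P i x` is the first component of `x` in the required decomposition
(`ProjectionalSkeleton.exists_isCompl`). These conditions amount to closure under countably many
functions, packed into one binary operation (`Node.step`), and an `M` that contains this operation
is closed under it.

Only `D` is known to belong to `M`. So the existence of a suitable operation is written as a
first-order statement about `D` in `H(θ)` (`IsDecomposingOperation`), and elementarity puts one into
`M`. The structure of `X` must then be recovered from `D` alone. The set `X` is the domain of the
functionals. Sums are read off from their values, since `D` separates points. The topology comes
from the intersections of half-spaces `{φ ≤ q}`, `φ ∈ D`, that absorb every point: they are
neighbourhoods of zero by Baire's theorem, and they form a base because `D` is norming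
(`Represents.inClosure_iff`).

From (b) to (a). Fix one large regular `θ` and let the index set consist of the countable `M ≼ H(θ)`
with `D ∈ M` for which `D ∩ M` norms `X ∩ M`, the latter being ensured by closure under choice
functions. The norming bounds the projections by `r` (`exists_projection`). Larger `M` have larger
ranges and smaller kernels, so the projections are compatible. Löwenheim–Skolem gives directedness
and covering, and unions of chains give suprema. -/

open FirstOrder Language

/-! ### Definable predicates over a collection of sets -/

/-- A predicate of `n` elements of `(N, ∈)` is first-order definable without parameters. -/
def DefinablePred {N : Set ZFSet.{u}} (n : ℕ) (P : (Fin n → N) → Prop) : Prop :=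
  ∃ φ : setLanguage.BoundedFormula Empty n, ∀ v, φ.Realize default v ↔ P v

theorem ZFSet.singleton_mem_pair (x y : ZFSet.{u}) : {x} ∈ ZFSet.pair x y := by
  simp [ZFSet.pair]

namespace DefinablePred

variable {N : Set ZFSet.{u}} {n : ℕ}

theorem mem (i j : Fin n) :
    DefinablePred n fun v : Fin n → N => (v i : ZFSet.{u}) ∈ (v j : ZFSet.{u}) := by
  let R : setLanguage.Relations 2 := SetTheoryRel.mem
  refine ⟨R.boundedFormula₂ (Term.var (Sum.inr i)) (Term.var (Sum.inr j)), fun v => ?_⟩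
  rw [BoundedFormula.realize_rel₂]
  rfl

theorem eq (i j : Fin n) : DefinablePred n fun v : Fin n → N => v i = v j :=
  ⟨(Term.var (Sum.inr i)).bdEqual (Term.var (Sum.inr j)), fun v => by simp⟩

theorem not {P : (Fin n → N) → Prop} (hP : DefinablePred n P) :
    DefinablePred n fun v => ¬ P v := by
  obtain ⟨φ, hφ⟩ := hP
  exact ⟨φ.not, fun v => by simp [hφ]⟩

theorem imp {P Q : (Fin n → N) → Prop} (hP : DefinablePred n P) (hQ : DefinablePred n Q) :
    DefinablePred n fun v => P v → Q v := by
  obtain ⟨φ, hφ⟩ := hP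
  obtain ⟨ψ, hψ⟩ := hQ
  exact ⟨φ.imp ψ, fun v => by simp [hφ, hψ]⟩

theorem and {P Q : (Fin n → N) → Prop} (hP : DefinablePred n P) (hQ : DefinablePred n Q) :
    DefinablePred n fun v => P v ∧ Q v := by
  obtain ⟨φ, hφ⟩ := hP
  obtain ⟨ψ, hψ⟩ := hQ
  exact ⟨φ ⊓ ψ, fun v => by simp [hφ, hψ]⟩

theorem or {P Q : (Fin n → N) → Prop} (hP : DefinablePred n P) (hQ : DefinablePred n Q) :
    DefinablePred n fun v => P v ∨ Q v := by
  obtain ⟨φ, hφ⟩ := hP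
  obtain ⟨ψ, hψ⟩ := hQ
  exact ⟨φ ⊔ ψ, fun v => by simp [hφ, hψ]⟩

theorem iff {P Q : (Fin n → N) → Prop} (hP : DefinablePred n P) (hQ : DefinablePred n Q) :
    DefinablePred n fun v => P v ↔ Q v := by
  obtain ⟨φ, hφ⟩ := hP
  obtain ⟨ψ, hψ⟩ := hQ
  exact ⟨φ.iff ψ, fun v => by simp [hφ, hψ]⟩

theorem ex {P : (Fin n → N) → N → Prop}
    (hP : DefinablePred (n + 1) fun v => P (fun i => v i.castSucc) (v (Fin.last n))) :
    DefinablePred n fun v => ∃ x, P v x := by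
  obtain ⟨φ, hφ⟩ := hP
  exact ⟨φ.ex, fun v => by simp [hφ]⟩

theorem all {P : (Fin n → N) → N → Prop}
    (hP : DefinablePred (n + 1) fun v => P (fun i => v i.castSucc) (v (Fin.last n))) :
    DefinablePred n fun v => ∀ x, P v x := by
  obtain ⟨φ, hφ⟩ := hP
  exact ⟨φ.all, fun v => by simp [hφ]⟩

theorem congr {P Q : (Fin n → N) → Prop} (hP : DefinablePred n P) (h : ∀ v, Q v ↔ P v) :
    DefinablePred n Q := by
  obtain ⟨φ, hφ⟩ := hP
  exact ⟨φ, fun v => by rw [hφ, h]⟩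

/-- Transitivity of `N` makes this notion and the following ones absolute: every element of a member
of `N` is in `N`, so quantifiers over `N` see whole sets. -/
theorem empty (hN : ∀ x ∈ N, ∀ y ∈ x, y ∈ N) (i : Fin n) :
    DefinablePred n fun v : Fin n → N => (v i : ZFSet.{u}) = ∅ := by
  have h : DefinablePred n fun v : Fin n → N => ∀ x : N, ¬ (x : ZFSet.{u}) ∈ (v i : ZFSet.{u}) :=
    all (not (mem _ _))
  refine h.congr fun v => ?_
  rw [ZFSet.eq_empty]
  exact ⟨fun h x => h x, fun h y hy => h ⟨y, hN _ (v i).2 _ hy⟩ hy⟩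

theorem insert_self (hN : ∀ x ∈ N, ∀ y ∈ x, y ∈ N) (i j : Fin n) :
    DefinablePred n fun v : Fin n → N =>
      (v i : ZFSet.{u}) = insert (v j : ZFSet.{u}) (v j : ZFSet.{u}) := by
  have h : DefinablePred n fun v : Fin n → N => ∀ x : N,
      (x : ZFSet.{u}) ∈ (v i : ZFSet.{u}) ↔ (x = v j ∨ (x : ZFSet.{u}) ∈ (v j : ZFSet.{u})) :=
    all (iff (mem _ _) (or (eq _ _) (mem _ _)))
  refine h.congr fun v => ?_
  constructor
  · intro h x
    rw [h, ZFSet.mem_insert_iff, Subtype.ext_iff]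
  · intro h
    ext z
    rw [ZFSet.mem_insert_iff]
    constructor
    · intro hz
      simpa [Subtype.ext_iff] using (h ⟨z, hN _ (v i).2 _ hz⟩).1 hz
    · rintro (rfl | hz)
      · exact (h (v j)).2 (Or.inl rfl)
      · exact (h ⟨z, hN _ (v j).2 _ hz⟩).2 (Or.inr hz)

theorem eq_unordered (hN : ∀ x ∈ N, ∀ y ∈ x, y ∈ N) (k i j : Fin n) :
    DefinablePred n fun v : Fin n → N =>
      (v k : ZFSet.{u}) = {(v i : ZFSet.{u}), (v j : ZFSet.{u})} := by
  have h : DefinablePred n fun v : Fin n → N => ∀ x : N,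
      (x : ZFSet.{u}) ∈ (v k : ZFSet.{u}) ↔ (x = v i ∨ x = v j) :=
    all (iff (mem _ _) (or (eq _ _) (eq _ _)))
  refine h.congr fun v => ?_
  constructor
  · intro h x
    rw [h, ZFSet.mem_pair, Subtype.ext_iff, Subtype.ext_iff]
  · intro h
    ext z
    rw [ZFSet.mem_pair]
    constructor
    · intro hz
      simpa [Subtype.ext_iff] using (h ⟨z, hN _ (v k).2 _ hz⟩).1 hz
    · rintro (rfl | rfl)
      · exact (h (v i)).2 (Or.inl rfl)
      · exact (h (v j)).2 (Or.inr rfl)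

theorem eq_pair (hN : ∀ x ∈ N, ∀ y ∈ x, y ∈ N) (k i j : Fin n) :
    DefinablePred n fun v : Fin n → N =>
      (v k : ZFSet.{u}) = ZFSet.pair (v i : ZFSet.{u}) (v j : ZFSet.{u}) := by
  have h : DefinablePred n fun v : Fin n → N => ∃ a b : N,
      (a : ZFSet.{u}) = {(v i : ZFSet.{u}), (v i : ZFSet.{u})} ∧
      (b : ZFSet.{u}) = {(v i : ZFSet.{u}), (v j : ZFSet.{u})} ∧
      (v k : ZFSet.{u}) = {(a : ZFSet.{u}), (b : ZFSet.{u})} :=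
    ex (ex (and (eq_unordered hN _ _ _) (and (eq_unordered hN _ _ _) (eq_unordered hN _ _ _))))
  refine h.congr fun v => ?_
  rw [ZFSet.pair]
  constructor
  · intro h
    -- Both components of the Kuratowski pair are elements of `v k`, hence available in `N`.
    refine ⟨⟨_, hN _ (v k).2 {(v i : ZFSet.{u})} (by simp [h])⟩,
      ⟨_, hN _ (v k).2 {(v i : ZFSet.{u}), (v j : ZFSet.{u})} (by simp [h])⟩, by simp, rfl, h⟩
  · rintro ⟨a, b, ha, hb, h⟩
    rw [h, ha, hb]
    simp

theorem pair_mem (hN : ∀ x ∈ N, ∀ y ∈ x, y ∈ N) (i j k : Fin n) :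
    DefinablePred n fun v : Fin n → N =>
      ZFSet.pair (v i : ZFSet.{u}) (v j : ZFSet.{u}) ∈ (v k : ZFSet.{u}) := by
  have h : DefinablePred n fun v : Fin n → N => ∃ p : N,
      (p : ZFSet.{u}) = ZFSet.pair (v i : ZFSet.{u}) (v j : ZFSet.{u}) ∧
      (p : ZFSet.{u}) ∈ (v k : ZFSet.{u}) :=
    ex (and (eq_pair hN _ _ _) (mem _ _))
  refine h.congr fun v => ?_
  exact ⟨fun h => ⟨⟨_, hN _ (v k).2 _ h⟩, rfl, h⟩, by rintro ⟨p, hp, h⟩; rwa [← hp]⟩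

theorem pair_pair_mem (hN : ∀ x ∈ N, ∀ y ∈ x, y ∈ N) (i j l k : Fin n) :
    DefinablePred n fun v : Fin n → N =>
      ZFSet.pair (ZFSet.pair (v i : ZFSet.{u}) (v j : ZFSet.{u})) (v l : ZFSet.{u}) ∈
        (v k : ZFSet.{u}) := by
  have h : DefinablePred n fun v : Fin n → N => ∃ p : N,
      (p : ZFSet.{u}) = ZFSet.pair (v i : ZFSet.{u}) (v j : ZFSet.{u}) ∧
      ZFSet.pair (p : ZFSet.{u}) (v l : ZFSet.{u}) ∈ (v k : ZFSet.{u}) :=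
    ex (and (eq_pair hN _ _ _) (pair_mem hN _ _ _))
  refine h.congr fun v => ?_
  constructor
  · intro h
    have h1 : ({ZFSet.pair (v i : ZFSet.{u}) (v j : ZFSet.{u})} : ZFSet.{u}) ∈ N :=
      hN _ (hN _ (v k).2 _ h) _ (ZFSet.singleton_mem_pair _ _)
    exact ⟨⟨_, hN _ h1 _ (ZFSet.mem_singleton.2 rfl)⟩, rfl, h⟩
  · rintro ⟨p, hp, h⟩
    rwa [← hp]

/-- An existential statement with parameters in an elementary substructure has a witness in it. -/
theorem exists_mem {P : (Fin n → N) → N → Prop}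
    (hP : DefinablePred (n + 1) fun v => P (fun i => v i.castSucc) (v (Fin.last n)))
    (M : setLanguage.ElementarySubstructure N) (x : Fin n → N) (hx : ∀ i, x i ∈ M)
    (h : ∃ a, P x a) : ∃ a ∈ M, P x a := by
  obtain ⟨φ, hφ⟩ := hP
  obtain ⟨a, ha⟩ := h
  let x' : Fin n → M := fun i => ⟨x i, hx i⟩
  have h1 : φ.ex.Realize (default : Empty → M) x' := by
    rw [← M.subtype.map_boundedFormula, BoundedFormula.realize_ex]
    refine ⟨a, ?_⟩
    rw [Subsingleton.elim (M.subtype ∘ default) default, hφ]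
    simpa [x', Function.comp_def] using ha
  rw [BoundedFormula.realize_ex] at h1
  obtain ⟨b, hb⟩ := h1
  refine ⟨b, b.2, ?_⟩
  rw [← M.subtype.map_boundedFormula, Subsingleton.elim (M.subtype ∘ default) default, hφ] at hb
  simpa [x', Function.comp_def] using hb

end DefinablePred

/-! ### Predicates over a collection of sets -/

section Predicates

variable {N : Set ZFSet.{u}}

/-- `q` belongs to the value of the function `φ` at `x`. -/
def ValMem (φ x q : N) : Prop :=
  ∃ c : N, ZFSet.pair (x : ZFSet.{u}) (c : ZFSet.{u}) ∈ (φ : ZFSet.{u}) ∧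
    (q : ZFSet.{u}) ∈ (c : ZFSet.{u})

/-- The triple `((a, b), k)` belongs to the value of the function `φ` at `x`. -/
def TripleValMem (φ x a b k : N) : Prop :=
  ∃ c : N, ZFSet.pair (x : ZFSet.{u}) (c : ZFSet.{u}) ∈ (φ : ZFSet.{u}) ∧
    ZFSet.pair (ZFSet.pair (a : ZFSet.{u}) (b : ZFSet.{u})) (k : ZFSet.{u}) ∈ (c : ZFSet.{u})

/-- `w` is the set of natural numbers and `A` is the graph of addition on it. -/
def IsNatAdd (w A : N) : Prop :=
  (∀ z : N, (z : ZFSet.{u}) = ∅ → (z : ZFSet.{u}) ∈ (w : ZFSet.{u})) ∧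
  (∀ n s : N, (n : ZFSet.{u}) ∈ (w : ZFSet.{u}) →
    (s : ZFSet.{u}) = insert (n : ZFSet.{u}) (n : ZFSet.{u}) → (s : ZFSet.{u}) ∈ (w : ZFSet.{u})) ∧
  (∀ n : N, (n : ZFSet.{u}) ∈ (w : ZFSet.{u}) → (n : ZFSet.{u}) = ∅ ∨
    ∃ m : N, (m : ZFSet.{u}) ∈ (w : ZFSet.{u}) ∧
      (n : ZFSet.{u}) = insert (m : ZFSet.{u}) (m : ZFSet.{u})) ∧
  ∀ n m k : N, (n : ZFSet.{u}) ∈ (w : ZFSet.{u}) → (m : ZFSet.{u}) ∈ (w : ZFSet.{u}) →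
    (ZFSet.pair (ZFSet.pair (n : ZFSet.{u}) (m : ZFSet.{u})) (k : ZFSet.{u}) ∈ (A : ZFSet.{u}) ↔
      ((m : ZFSet.{u}) = ∅ ∧ k = n) ∨
      ∃ m' k' : N, (m : ZFSet.{u}) = insert (m' : ZFSet.{u}) (m' : ZFSet.{u}) ∧
        (k : ZFSet.{u}) = insert (k' : ZFSet.{u}) (k' : ZFSet.{u}) ∧
        ZFSet.pair (ZFSet.pair (n : ZFSet.{u}) (m' : ZFSet.{u})) (k' : ZFSet.{u}) ∈
          (A : ZFSet.{u}))

/-- `z = x + y`, as seen by the functionals in `D`. -/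
def IsSum (D w A x y z : N) : Prop :=
  ∀ φ a b a' b' a'' b'' k : N, (φ : ZFSet.{u}) ∈ (D : ZFSet.{u}) →
    (a : ZFSet.{u}) ∈ (w : ZFSet.{u}) → (b : ZFSet.{u}) ∈ (w : ZFSet.{u}) →
    (a' : ZFSet.{u}) ∈ (w : ZFSet.{u}) → (b' : ZFSet.{u}) ∈ (w : ZFSet.{u}) →
    (k : ZFSet.{u}) ∈ (w : ZFSet.{u}) →
    ZFSet.pair (ZFSet.pair (a : ZFSet.{u}) (a' : ZFSet.{u})) (a'' : ZFSet.{u}) ∈ (A : ZFSet.{u}) →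
    ZFSet.pair (ZFSet.pair (b : ZFSet.{u}) (b' : ZFSet.{u})) (b'' : ZFSet.{u}) ∈ (A : ZFSet.{u}) →
    (TripleValMem φ x a b k → TripleValMem φ y a' b' k → TripleValMem φ z a'' b'' k) ∧
    (¬ TripleValMem φ x a b k → ¬ TripleValMem φ y a' b' k → ¬ TripleValMem φ z a'' b'' k)

/-- `d` lies in the intersection of the half-spaces `{φ ≤ q}`, `(φ, q) ∈ R`. -/
def InHalfSpaces (D R d : N) : Prop :=
  ∀ φ q : N, (φ : ZFSet.{u}) ∈ (D : ZFSet.{u}) →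
    ZFSet.pair (φ : ZFSet.{u}) (q : ZFSet.{u}) ∈ (R : ZFSet.{u}) → ¬ ValMem φ d q

/-- Every point of `X` enters the intersection of half-spaces given by `R` by repeated halving. -/
def IsAbsorbing (D X w A R : N) : Prop :=
  ∀ x V : N, (x : ZFSet.{u}) ∈ (X : ZFSet.{u}) → (x : ZFSet.{u}) ∈ (V : ZFSet.{u}) →
    (∀ v h : N, (v : ZFSet.{u}) ∈ (V : ZFSet.{u}) → (h : ZFSet.{u}) ∈ (X : ZFSet.{u}) →
      IsSum D w A h h v → (h : ZFSet.{u}) ∈ (V : ZFSet.{u})) →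
    ∃ v : N, (v : ZFSet.{u}) ∈ (V : ZFSet.{u}) ∧ InHalfSpaces D R v

/-- `y` lies in the norm closure of the set of points of `X` that belong to `C`. -/
def InClosure (D X w A C y : N) : Prop :=
  ∀ R : N, IsAbsorbing D X w A R → ∃ a d d' : N, (a : ZFSet.{u}) ∈ (C : ZFSet.{u}) ∧
    (a : ZFSet.{u}) ∈ (X : ZFSet.{u}) ∧ (d : ZFSet.{u}) ∈ (X : ZFSet.{u}) ∧
    (d' : ZFSet.{u}) ∈ (X : ZFSet.{u}) ∧ InHalfSpaces D R d ∧ InHalfSpaces D R d' ∧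
    IsSum D w A a d y ∧ IsSum D w A y d' a

/-- All functionals in `D ∩ C` agree at `x` and `y`. -/
def AgreeAt (D C x y : N) : Prop :=
  ∀ φ q : N, (φ : ZFSet.{u}) ∈ (D : ZFSet.{u}) → (φ : ZFSet.{u}) ∈ (C : ZFSet.{u}) →
    (ValMem φ x q ↔ ValMem φ y q)

/-- The closure of `X ∩ C` is a subspace complementary to the annihilator of `D ∩ C`. -/
def Decomposes (D X w A C : N) : Prop :=
  (∀ x : N, (x : ZFSet.{u}) ∈ (X : ZFSet.{u}) → ∃ y : N, (y : ZFSet.{u}) ∈ (X : ZFSet.{u}) ∧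
    InClosure D X w A C y ∧ AgreeAt D C x y) ∧
  (∀ y y' : N, (y : ZFSet.{u}) ∈ (X : ZFSet.{u}) → (y' : ZFSet.{u}) ∈ (X : ZFSet.{u}) →
    InClosure D X w A C y → InClosure D X w A C y' → AgreeAt D C y y' → y = y') ∧
  (∀ x y z : N, (x : ZFSet.{u}) ∈ (X : ZFSet.{u}) → (y : ZFSet.{u}) ∈ (X : ZFSet.{u}) →
    (z : ZFSet.{u}) ∈ (X : ZFSet.{u}) → InClosure D X w A C x → InClosure D X w A C y →
    IsSum D w A z y x → InClosure D X w A C z) ∧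
  ∀ x h : N, (x : ZFSet.{u}) ∈ (X : ZFSet.{u}) → (h : ZFSet.{u}) ∈ (X : ZFSet.{u}) →
    InClosure D X w A C x → IsSum D w A h h x → InClosure D X w A C h

/-- `C` is closed under the binary operation with graph `E`. -/
def IsClosedUnder (E C : N) : Prop :=
  ∀ s t : N, (s : ZFSet.{u}) ∈ (C : ZFSet.{u}) → (t : ZFSet.{u}) ∈ (C : ZFSet.{u}) →
    ∃ c : N, (c : ZFSet.{u}) ∈ (C : ZFSet.{u}) ∧
      ZFSet.pair (ZFSet.pair (s : ZFSet.{u}) (t : ZFSet.{u})) (c : ZFSet.{u}) ∈ (E : ZFSet.{u})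

/-- `X` is the domain of the functions in `D`, `w` and `A` are the natural numbers and their
addition, and `E` is a binary operation on a superset `Z` of `X ∪ D` such that every subset of `Z`
that contains `z` and is closed under `E` gives a decomposition of `X`. -/
def IsDecomposingOperation (D X w A Z E z : N) : Prop :=
  (∀ x : N, (x : ZFSet.{u}) ∈ (X : ZFSet.{u}) ↔ ∃ φ c : N, (φ : ZFSet.{u}) ∈ (D : ZFSet.{u}) ∧
    ZFSet.pair (x : ZFSet.{u}) (c : ZFSet.{u}) ∈ (φ : ZFSet.{u})) ∧
  IsNatAdd w A ∧
  (∀ x : N, (x : ZFSet.{u}) ∈ (X : ZFSet.{u}) → (x : ZFSet.{u}) ∈ (Z : ZFSet.{u})) ∧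
  (∀ x : N, (x : ZFSet.{u}) ∈ (D : ZFSet.{u}) → (x : ZFSet.{u}) ∈ (Z : ZFSet.{u})) ∧
  (z : ZFSet.{u}) ∈ (Z : ZFSet.{u}) ∧ IsClosedUnder E Z ∧
  ∀ C : N, (∀ x : N, (x : ZFSet.{u}) ∈ (C : ZFSet.{u}) → (x : ZFSet.{u}) ∈ (Z : ZFSet.{u})) →
    (z : ZFSet.{u}) ∈ (C : ZFSet.{u}) → IsClosedUnder E C → Decomposes D X w A C

end Predicates

/-! ### Definability of the predicates, by recursion on the shape of their formulas. -/

namespace DefinablePred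

variable {N : Set ZFSet.{u}} {n : ℕ}

theorem valMem (hN : ∀ x ∈ N, ∀ y ∈ x, y ∈ N) (φ x q : Fin n) :
    DefinablePred n fun v : Fin n → N => ValMem (v φ) (v x) (v q) :=
  ex (and (pair_mem hN _ _ _) (mem _ _))

theorem tripleValMem (hN : ∀ x ∈ N, ∀ y ∈ x, y ∈ N) (φ x a b k : Fin n) :
    DefinablePred n fun v : Fin n → N => TripleValMem (v φ) (v x) (v a) (v b) (v k) :=
  ex (and (pair_mem hN _ _ _) (pair_pair_mem hN _ _ _ _))

theorem isNatAdd (hN : ∀ x ∈ N, ∀ y ∈ x, y ∈ N) (w A : Fin n) :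
    DefinablePred n fun v : Fin n → N => IsNatAdd (v w) (v A) := by
  unfold IsNatAdd
  repeat' first
    | exact pair_pair_mem hN _ _ _ _ | exact insert_self hN _ _ | exact empty hN _
    | exact mem _ _ | exact eq _ _
    | apply and | apply or | apply imp | apply iff | apply all | apply ex

theorem isSum (hN : ∀ x ∈ N, ∀ y ∈ x, y ∈ N) (D w A x y z : Fin n) :
    DefinablePred n fun v : Fin n → N => IsSum (v D) (v w) (v A) (v x) (v y) (v z) := by
  unfold IsSum
  repeat' first
    | exact pair_pair_mem hN _ _ _ _ | exact tripleValMem hN _ _ _ _ _ | exact mem _ _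
    | apply and | apply not | apply imp | apply all

theorem inHalfSpaces (hN : ∀ x ∈ N, ∀ y ∈ x, y ∈ N) (D R d : Fin n) :
    DefinablePred n fun v : Fin n → N => InHalfSpaces (v D) (v R) (v d) := by
  unfold InHalfSpaces
  repeat' first
    | exact pair_mem hN _ _ _ | exact valMem hN _ _ _ | exact mem _ _
    | apply not | apply imp | apply all

theorem isAbsorbing (hN : ∀ x ∈ N, ∀ y ∈ x, y ∈ N) (D X w A R : Fin n) :
    DefinablePred n fun v : Fin n → N => IsAbsorbing (v D) (v X) (v w) (v A) (v R) := by
  unfold IsAbsorbing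
  repeat' first
    | exact isSum hN _ _ _ _ _ _ | exact inHalfSpaces hN _ _ _ | exact mem _ _
    | apply and | apply imp | apply all | apply ex

theorem inClosure (hN : ∀ x ∈ N, ∀ y ∈ x, y ∈ N) (D X w A C y : Fin n) :
    DefinablePred n fun v : Fin n → N => InClosure (v D) (v X) (v w) (v A) (v C) (v y) := by
  unfold InClosure
  repeat' first
    | exact isSum hN _ _ _ _ _ _ | exact inHalfSpaces hN _ _ _ | exact isAbsorbing hN _ _ _ _ _
    | exact mem _ _ | apply and | apply imp | apply all | apply ex

theorem agreeAt (hN : ∀ x ∈ N, ∀ y ∈ x, y ∈ N) (D C x y : Fin n) :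
    DefinablePred n fun v : Fin n → N => AgreeAt (v D) (v C) (v x) (v y) := by
  unfold AgreeAt
  repeat' first
    | exact valMem hN _ _ _ | exact mem _ _ | apply imp | apply iff | apply all

theorem decomposes (hN : ∀ x ∈ N, ∀ y ∈ x, y ∈ N) (D X w A C : Fin n) :
    DefinablePred n fun v : Fin n → N => Decomposes (v D) (v X) (v w) (v A) (v C) := by
  unfold Decomposes
  repeat' first
    | exact isSum hN _ _ _ _ _ _ | exact inClosure hN _ _ _ _ _ _ | exact agreeAt hN _ _ _ _
    | exact mem _ _ | exact eq _ _ | apply and | apply imp | apply all | apply ex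

theorem isClosedUnder (hN : ∀ x ∈ N, ∀ y ∈ x, y ∈ N) (E C : Fin n) :
    DefinablePred n fun v : Fin n → N => IsClosedUnder (v E) (v C) := by
  unfold IsClosedUnder
  repeat' first
    | exact pair_pair_mem hN _ _ _ _ | exact mem _ _ | apply and | apply imp | apply all | apply ex

theorem isDecomposingOperation (hN : ∀ x ∈ N, ∀ y ∈ x, y ∈ N) (D X w A Z E z : Fin n) :
    DefinablePred n fun v : Fin n → N =>
      IsDecomposingOperation (v D) (v X) (v w) (v A) (v Z) (v E) (v z) := by
  unfold IsDecomposingOperation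
  repeat' first
    | exact decomposes hN _ _ _ _ _ | exact isClosedUnder hN _ _ | exact isNatAdd hN _ _
    | exact pair_mem hN _ _ _ | exact mem _ _
    | apply and | apply imp | apply iff | apply all | apply ex

end DefinablePred

/-! ### Witnesses and closure properties inside an elementary substructure. -/

/-- Witnesses are moved into `M` one at a time; each becomes a parameter for the next existential
statement. -/
theorem exists_isDecomposingOperation_mem {N : Set ZFSet.{u}} (hN : ∀ x ∈ N, ∀ y ∈ x, y ∈ N)
    (M : setLanguage.ElementarySubstructure N) {D : N} (hD : D ∈ M)
    (h : ∃ X w A Z E z : N, IsDecomposingOperation D X w A Z E z) :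
    ∃ X w A Z E z : N, Z ∈ M ∧ E ∈ M ∧ z ∈ M ∧ IsDecomposingOperation D X w A Z E z := by
  obtain ⟨X, hX, h⟩ := DefinablePred.exists_mem (P := fun v X => ∃ w A Z E z : N,
    IsDecomposingOperation (v 0) X w A Z E z) (n := 1)
    (by repeat' first | exact DefinablePred.isDecomposingOperation hN _ _ _ _ _ _ _
                      | apply DefinablePred.ex) M ![D] (by simp [hD]) h
  obtain ⟨w, hw, h⟩ := DefinablePred.exists_mem (P := fun v w => ∃ A Z E z : N,
    IsDecomposingOperation (v 0) (v 1) w A Z E z) (n := 2)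
    (by repeat' first | exact DefinablePred.isDecomposingOperation hN _ _ _ _ _ _ _
                      | apply DefinablePred.ex) M ![D, X] (by simp [Fin.forall_fin_succ, *]) h
  obtain ⟨A, hA, h⟩ := DefinablePred.exists_mem (P := fun v A => ∃ Z E z : N,
    IsDecomposingOperation (v 0) (v 1) (v 2) A Z E z) (n := 3)
    (by repeat' first | exact DefinablePred.isDecomposingOperation hN _ _ _ _ _ _ _
                      | apply DefinablePred.ex) M ![D, X, w] (by simp [Fin.forall_fin_succ, *]) h
  obtain ⟨Z, hZ, h⟩ := DefinablePred.exists_mem (P := fun v Z => ∃ E z : N,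
    IsDecomposingOperation (v 0) (v 1) (v 2) (v 3) Z E z) (n := 4)
    (by repeat' first | exact DefinablePred.isDecomposingOperation hN _ _ _ _ _ _ _
                      | apply DefinablePred.ex) M ![D, X, w, A]
    (by simp [Fin.forall_fin_succ, *]) h
  obtain ⟨E, hE, h⟩ := DefinablePred.exists_mem (P := fun v E => ∃ z : N,
    IsDecomposingOperation (v 0) (v 1) (v 2) (v 3) (v 4) E z) (n := 5)
    (by repeat' first | exact DefinablePred.isDecomposingOperation hN _ _ _ _ _ _ _
                      | apply DefinablePred.ex) M ![D, X, w, A, Z]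
    (by simp [Fin.forall_fin_succ, *]) h
  obtain ⟨z, hz, h⟩ := DefinablePred.exists_mem (P := fun v z =>
    IsDecomposingOperation (v 0) (v 1) (v 2) (v 3) (v 4) (v 5) z) (n := 6)
    (DefinablePred.isDecomposingOperation hN _ _ _ _ _ _ _) M ![D, X, w, A, Z, E]
    (by simp [Fin.forall_fin_succ, *]) h
  exact ⟨X, w, A, Z, E, z, hZ, hE, hz, h⟩

/-- Here `C` is `Z ∩ M`. Having a value of `E` at `s`, `t` inside `Z` is a statement with parameters
in `M`, so some value lies in `M`. -/
theorem IsClosedUnder.of_elementary {N : Set ZFSet.{u}} (hN : ∀ x ∈ N, ∀ y ∈ x, y ∈ N)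
    (M : setLanguage.ElementarySubstructure N) {Z E C : N} (hZ : Z ∈ M) (hE : E ∈ M)
    (hC : ∀ x : N, (x : ZFSet.{u}) ∈ (C : ZFSet.{u}) ↔ (x : ZFSet.{u}) ∈ (Z : ZFSet.{u}) ∧ x ∈ M)
    (h : IsClosedUnder E Z) : IsClosedUnder E C := by
  intro s t hs ht
  rw [hC] at hs ht
  obtain ⟨c, hc, h⟩ := DefinablePred.exists_mem (P := fun v (c : N) =>
    (c : ZFSet.{u}) ∈ (v 0 : ZFSet.{u}) ∧
      ZFSet.pair (ZFSet.pair (v 2 : ZFSet.{u}) (v 3 : ZFSet.{u})) (c : ZFSet.{u}) ∈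
        (v 1 : ZFSet.{u})) (n := 4)
    (DefinablePred.and (DefinablePred.mem _ _) (DefinablePred.pair_pair_mem hN _ _ _ _))
    M ![Z, E, s, t] (by simp [Fin.forall_fin_succ, *]) (h s t hs.1 ht.1)
  exact ⟨c, (hC c).2 ⟨h.1, hc⟩, h.2⟩

/-! ### The collections `H(θ)` -/

theorem transClosure_subset_of_subset {x y : ZFSet.{u}} (h : y ⊆ x) :
    transClosure y ⊆ transClosure x := by
  intro z hz
  cases hz with
  | single h1 => exact .single (h h1)
  | tail h1 h2 => exact .tail h1 (h h2)

theorem transClosure_subset_of_mem {x y : ZFSet.{u}} (h : y ∈ x) :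
    transClosure y ⊆ transClosure x :=
  fun _ hz => hz.tail h

/-- Because of this, a quantifier over `H(θ)` reaches all subsets of a given member. The set
quantifiers over `V`, `R` and `C` in the predicates rely on it. -/
theorem hereditary_of_subset {θ : Cardinal.{u}} {x y : ZFSet.{u}} (h : y ⊆ x)
    (hx : x ∈ hereditary θ) : y ∈ hereditary θ :=
  (Cardinal.mk_le_mk_of_subset (transClosure_subset_of_subset h)).trans_lt hx

theorem hereditary_of_mem {θ : Cardinal.{u}} (x : ZFSet.{u}) (hx : x ∈ hereditary θ)
    (y : ZFSet.{u}) (h : y ∈ x) : y ∈ hereditary θ :=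
  (Cardinal.mk_le_mk_of_subset (transClosure_subset_of_mem h)).trans_lt hx

/-- Rank drops along membership, so the transitive closure lies in the von Neumann stage of index
`x.rank`. -/
theorem small_transClosure (x : ZFSet.{u}) : Small.{u} (transClosure x) := by
  have h : transClosure x ⊆ ((ZFSet.vonNeumann x.rank : ZFSet.{u}) : Set ZFSet.{u}) := by
    intro y hy
    have hr : y.rank < x.rank := by
      induction hy with
      | single h => exact ZFSet.rank_lt_of_mem h
      | tail _ h ih => exact ih.trans (ZFSet.rank_lt_of_mem h)
    exact ZFSet.mem_vonNeumann.2 hr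
  have : Small.{u} ((ZFSet.vonNeumann x.rank : ZFSet.{u}) : Set ZFSet.{u}) := ZFSet.small_coe _
  exact small_subset h

theorem exists_forall_mem_hereditary (x : ZFSet.{u}) :
    ∃ θ₀ : Cardinal.{u}, ∀ θ, θ₀ ≤ θ → x ∈ hereditary θ := by
  have := small_transClosure x
  refine ⟨Order.succ (Cardinal.mk (Shrink.{u} (transClosure x))), fun θ h => ?_⟩
  have h1 := Order.succ_le_iff.1 h
  have h2 : Cardinal.mk (transClosure x) =
      Cardinal.lift.{u + 1} (Cardinal.mk (Shrink.{u} (transClosure x))) := by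
    rw [Cardinal.lift_mk_shrink'']
  change Cardinal.mk (transClosure x) < Cardinal.lift.{u + 1} θ
  rw [h2]
  exact Cardinal.lift_lt.2 h1

/-! ### Codes of numbers -/

theorem natCode_zero : natCode.{u} 0 = ∅ := by simp [natCode]

theorem natCode_succ (n : ℕ) : natCode.{u} (n + 1) = insert (natCode n) (natCode n) := by
  simp [natCode, Ordinal.toZFSet_add_one]

theorem natCode_injective : Function.Injective natCode.{u} := fun m n h => by
  simpa using Ordinal.toZFSet_injective h

theorem natCode_succ_ne_empty (n : ℕ) : natCode.{u} (n + 1) ≠ ∅ := by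
  rw [← natCode_zero]
  exact natCode_injective.ne (Nat.succ_ne_zero n)

theorem ZFSet.insert_self_injective :
    Function.Injective fun x : ZFSet.{u} => (insert x x : ZFSet.{u}) := by
  intro x y h
  have hx : x ∈ (insert y y : ZFSet.{u}) := by
    rw [← show (insert x x : ZFSet.{u}) = insert y y from h]
    exact ZFSet.mem_insert x x
  have hy : y ∈ (insert x x : ZFSet.{u}) := by
    rw [show (insert x x : ZFSet.{u}) = insert y y from h]
    exact ZFSet.mem_insert y y
  rw [ZFSet.mem_insert_iff] at hx hy
  rcases hx with hx | hx
  · exact hx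
  · rcases hy with hy | hy
    · exact hy.symm
    · exact absurd hy (ZFSet.mem_asymm hx)

/-- The code of the fraction `(a - b) / (c + 1)`. -/
noncomputable def fracCode (a b c : ℕ) : ZFSet.{u} :=
  ZFSet.pair (ZFSet.pair (natCode a) (natCode b)) (natCode c)

theorem fracCode_inj {a b c a' b' c' : ℕ} :
    fracCode.{u} a b c = fracCode a' b' c' ↔ a = a' ∧ b = b' ∧ c = c' := by
  simp [fracCode, natCode_injective.eq_iff, and_assoc]

theorem mem_realCode {r : ℝ} {q : ZFSet.{u}} :
    q ∈ realCode r ↔ ∃ a b c : ℕ, q = fracCode a b c ∧ ((a : ℝ) - b) / (c + 1) < r := by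
  rw [realCode, ZFSet.mem_range]
  constructor
  · rintro ⟨⟨⟨⟨a, b⟩, c⟩, h⟩, rfl⟩
    exact ⟨a, b, c, rfl, h⟩
  · rintro ⟨a, b, c, rfl, h⟩
    exact ⟨⟨((a, b), c), h⟩, rfl⟩

theorem fracCode_mem_realCode {r : ℝ} {a b c : ℕ} :
    fracCode.{u} a b c ∈ realCode r ↔ ((a : ℝ) - b) / (c + 1) < r := by
  rw [mem_realCode]
  constructor
  · rintro ⟨a', b', c', h, h'⟩
    obtain ⟨rfl, rfl, rfl⟩ := fracCode_inj.1 h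
    exact h'
  · exact fun h => ⟨a, b, c, rfl, h⟩

theorem exists_frac_between {s t : ℝ} (h : s < t) :
    ∃ a b c : ℕ, s < ((a : ℝ) - b) / (c + 1) ∧ ((a : ℝ) - b) / (c + 1) < t := by
  obtain ⟨q, hs, ht⟩ := exists_rat_btwn h
  -- The numerator is split into positive and negative parts; the denominator is shifted since the
  -- fractions have denominator `c + 1`.
  refine ⟨q.num.toNat, (-q.num).toNat, q.den - 1, ?_⟩
  have h1 : ((q.num.toNat : ℝ) - ((-q.num).toNat : ℝ)) = (q.num : ℝ) := by
    exact_mod_cast congrArg (Int.cast : ℤ → ℝ) (Int.toNat_sub_toNat_neg q.num)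
  have h2 : ((q.den - 1 : ℕ) : ℝ) + 1 = q.den := by
    exact_mod_cast Nat.sub_add_cancel q.den_pos
  rw [h1, h2, ← Rat.cast_def]
  exact ⟨hs, ht⟩

theorem realCode_injective : Function.Injective realCode.{u} := by
  intro s t h
  by_contra hne
  rcases lt_or_gt_of_ne hne with hlt | hlt
  · obtain ⟨a, b, c, h1, h2⟩ := exists_frac_between hlt
    exact absurd (fracCode_mem_realCode.1 (h ▸ fracCode_mem_realCode.{u}.2 h2)) h1.not_gt
  · obtain ⟨a, b, c, h1, h2⟩ := exists_frac_between hlt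
    exact absurd (fracCode_mem_realCode.1 (h ▸ fracCode_mem_realCode.{u}.2 h2)) h1.not_gt

/-- Addition of reals is determined by comparisons with fractions of a common denominator. -/
theorem eq_add_iff_frac {x y z : ℝ} : z = x + y ↔ ∀ a b a' b' c : ℕ,
    (((a : ℝ) - b) / (c + 1) < x → ((a' : ℝ) - b') / (c + 1) < y →
      (((a + a' : ℕ) : ℝ) - (b + b' : ℕ)) / (c + 1) < z) ∧
    (¬ ((a : ℝ) - b) / (c + 1) < x → ¬ ((a' : ℝ) - b') / (c + 1) < y →
      ¬ (((a + a' : ℕ) : ℝ) - (b + b' : ℕ)) / (c + 1) < z) := by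
  have key : ∀ a b a' b' c : ℕ, (((a + a' : ℕ) : ℝ) - (b + b' : ℕ)) / (c + 1) =
      ((a : ℝ) - b) / (c + 1) + ((a' : ℝ) - b') / (c + 1) := by
    intro a b a' b' c
    push_cast
    ring
  have approx : ∀ (c : ℕ) (t : ℝ), ∃ a b : ℕ,
      ((a : ℝ) - b) / (c + 1) < t ∧ t ≤ ((a : ℝ) - b) / (c + 1) + 1 / (c + 1) := by
    intro c t
    have hc : (0 : ℝ) < c + 1 := by positivity
    -- The greatest numerator with `m / (c + 1) < t`.
    let m : ℤ := ⌈t * (c + 1)⌉ - 1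
    have h1 : ((m.toNat : ℝ) - ((-m).toNat : ℝ)) = (m : ℝ) := by
      exact_mod_cast congrArg (Int.cast : ℤ → ℝ) (Int.toNat_sub_toNat_neg m)
    refine ⟨m.toNat, (-m).toNat, ?_⟩
    rw [h1, ← add_div, div_lt_iff₀ hc, le_div_iff₀ hc]
    have h2 := Int.ceil_lt_add_one (t * (c + 1))
    have h3 := Int.le_ceil (t * (c + 1))
    simp only [m]
    push_cast
    constructor <;> linarith
  constructor
  · rintro rfl a b a' b' c
    rw [key]
    constructor <;> intro h1 h2 <;> linarith
  · intro h
    by_contra hne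
    rcases lt_or_gt_of_ne hne with hlt | hlt
    -- Each of the two roundings costs at most `1 / (c + 1)`, whence the half. The other case rounds
    -- up instead, by raising both numerators by one.
    · obtain ⟨c, hc⟩ := exists_nat_one_div_lt (show 0 < (x + y - z) / 2 by linarith)
      obtain ⟨a, b, h1, h2⟩ := approx c x
      obtain ⟨a', b', h3, h4⟩ := approx c y
      have := (h a b a' b' c).1 h1 h3
      rw [key] at this
      linarith
    · obtain ⟨c, hc⟩ := exists_nat_one_div_lt (show 0 < (z - (x + y)) / 2 by linarith)
      obtain ⟨a, b, h1, h2⟩ := approx c x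
      obtain ⟨a', b', h3, h4⟩ := approx c y
      have e1 : (((a + 1 : ℕ) : ℝ) - b) / (c + 1) = ((a : ℝ) - b) / (c + 1) + 1 / (c + 1) := by
        push_cast; ring
      have e2 : (((a' + 1 : ℕ) : ℝ) - b') / (c + 1) = ((a' : ℝ) - b') / (c + 1) + 1 / (c + 1) := by
        push_cast; ring
      have := (h (a + 1) b (a' + 1) b' c).2 (by rw [e1]; linarith) (by rw [e2]; linarith)
      rw [key, e1, e2] at this
      linarith

/-! ### Codes of functionals -/

section Functionals

variable {X : Type u} [NormedAddCommGroup X] [NormedSpace ℝ X] (e : X ↪ ZFSet.{u})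

theorem pair_mem_functionalCode {φ : StrongDual ℝ X} {p c : ZFSet.{u}} :
    ZFSet.pair p c ∈ functionalCode e φ ↔ ∃ x, p = e x ∧ c = realCode (φ x) := by
  simp only [functionalCode, ZFSet.mem_range, ZFSet.pair_inj]
  exact ⟨fun ⟨x, h1, h2⟩ => ⟨x, h1.symm, h2.symm⟩, fun ⟨x, h1, h2⟩ => ⟨x, h1.symm, h2.symm⟩⟩

theorem apply_pair_mem_functionalCode {φ : StrongDual ℝ X} {x : X} {c : ZFSet.{u}} :
    ZFSet.pair (e x) c ∈ functionalCode e φ ↔ c = realCode (φ x) := by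
  rw [pair_mem_functionalCode]
  constructor
  · rintro ⟨y, h1, h2⟩
    rwa [e.injective h1]
  · exact fun h => ⟨x, rfl, h⟩

theorem functionalCode_injective : Function.Injective (functionalCode e) := by
  intro φ ψ h
  ext x
  have h1 := (apply_pair_mem_functionalCode e (φ := φ) (x := x)).2 rfl
  rw [h, apply_pair_mem_functionalCode] at h1
  exact realCode_injective h1

theorem mem_dualSetCode {D : Set (StrongDual ℝ X)} {p : ZFSet.{u}} :
    p ∈ dualSetCode e D ↔ ∃ φ ∈ D, p = functionalCode e φ := by
  simp only [dualSetCode, ZFSet.mem_range, Subtype.exists, exists_prop]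
  exact ⟨fun ⟨x, h1, h2⟩ => ⟨x, h1, h2.symm⟩, fun ⟨x, h1, h2⟩ => ⟨x, h1, h2.symm⟩⟩

theorem functionalCode_mem_dualSetCode {D : Set (StrongDual ℝ X)} {φ : StrongDual ℝ X} :
    functionalCode e φ ∈ dualSetCode e D ↔ φ ∈ D := by
  rw [mem_dualSetCode]
  constructor
  · rintro ⟨ψ, hψ, h⟩
    rwa [functionalCode_injective e h]
  · exact fun h => ⟨φ, h, rfl⟩

end Functionals

/-! ### Norming sets and absorbing convex sets -/

section Analysis

variable {X : Type u} [NormedAddCommGroup X] [NormedSpace ℝ X]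

theorem IsNorming.norm_le {r : ℝ} {D : Set (StrongDual ℝ X)} (hD : IsNorming r D) (hr : 0 ≤ r)
    {ε : ℝ} (hε : 0 ≤ ε) {x : X} (h : ∀ φ ∈ D, |φ x| ≤ ε * ‖φ‖) : ‖x‖ ≤ r * ε := by
  -- Nonnegativity of `ε` covers the empty supremum, which is zero.
  refine (hD x).trans (mul_le_mul_of_nonneg_left (Real.iSup_le (fun φ => ?_) hε) hr)
  exact (div_le_iff₀ (norm_pos_iff.2 φ.2.2)).2 (h _ φ.2.1)

theorem IsNorming.eq_of_forall {r : ℝ} {D : Set (StrongDual ℝ X)} (hD : IsNorming r D)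
    (hr : 0 ≤ r) {x y : X} (h : ∀ φ ∈ D, φ x = φ y) : x = y := by
  have := hD.norm_le hr le_rfl (x := x - y) fun φ hφ => by simp [h φ hφ]
  rw [mul_zero] at this
  exact sub_eq_zero.1 (norm_le_zero_iff.1 this)

/-- The sets `2 ^ n • K` are closed and cover `X`, so by Baire's theorem `K` has an interior point
`q`. Some `t • -q` with `t > 0` lies in `K`, and zero, a convex combination of `q` and `t • -q` with
positive weight at `q`, is interior as well. -/
theorem Convex.exists_ball_subset_of_absorbing [CompleteSpace X] {K : Set X} (hK : Convex ℝ K)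
    (hc : IsClosed K) (ha : ∀ x : X, ∃ n : ℕ, (1 / 2 : ℝ) ^ n • x ∈ K) :
    ∃ ε > 0, Metric.ball (0 : X) ε ⊆ K := by
  have h2 : ∀ n : ℕ, (1 / 2 : ℝ) ^ n ≠ 0 := fun n => by positivity
  obtain ⟨n, p, hp⟩ := nonempty_interior_of_iUnion_of_closed
    (f := fun n : ℕ => (fun x : X => (1 / 2 : ℝ) ^ n • x) ⁻¹' K)
    (fun n => hc.preimage (continuous_const_smul _))
    (Set.eq_univ_of_forall fun x => Set.mem_iUnion.2 (ha x))
  have hp' : (1 / 2 : ℝ) ^ n • p ∈ interior K := by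
    have := (Homeomorph.smulOfNeZero ((1 / 2 : ℝ) ^ n) (h2 n) (α := X)).preimage_interior K
    change p ∈ interior ((Homeomorph.smulOfNeZero ((1 / 2 : ℝ) ^ n) (h2 n) (α := X)) ⁻¹' K) at hp
    rw [← this] at hp
    exact hp
  set q := (1 / 2 : ℝ) ^ n • p
  obtain ⟨m, hm⟩ := ha (-q)
  have ht : (0 : ℝ) < (1 / 2 : ℝ) ^ m := by positivity
  set t := (1 / 2 : ℝ) ^ m
  have h0 := hK.combo_interior_self_mem_interior hp' hm (a := t / (1 + t)) (b := 1 / (1 + t))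
    (by positivity) (by positivity) (by field_simp; ring)
  have h1 : (t / (1 + t)) • q + (1 / (1 + t)) • t • -q = 0 := by
    clear_value q
    rw [smul_smul, smul_neg, ← sub_eq_add_neg, ← sub_smul]
    convert zero_smul ℝ q using 2
    ring
  rw [h1] at h0
  obtain ⟨ε, hε, h⟩ := Metric.isOpen_iff.1 isOpen_interior _ h0
  exact ⟨ε, hε, h.trans interior_subset⟩

end Analysis

/-! ### Interpretation of the predicates over `H(θ)` -/

section Interpretation

theorem hereditary_right_of_pair {θ : Cardinal.{u}} {x y : ZFSet.{u}}
    (h : ZFSet.pair x y ∈ hereditary θ) : y ∈ hereditary θ :=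
  hereditary_of_mem _ (hereditary_of_mem _ h {x, y} (by simp [ZFSet.pair])) _ (by simp)

theorem hereditary_left_of_pair {θ : Cardinal.{u}} {x y : ZFSet.{u}}
    (h : ZFSet.pair x y ∈ hereditary θ) : x ∈ hereditary θ :=
  hereditary_of_mem _ (hereditary_of_mem _ h {x, y} (by simp [ZFSet.pair])) _ (by simp)

variable {X : Type u} [NormedAddCommGroup X] [NormedSpace ℝ X] {e : X ↪ ZFSet.{u}}
  {θ : Cardinal.{u}}

theorem valMem_iff {φN x q : hereditary θ} {φ : StrongDual ℝ X}
    (hφ : (φN : ZFSet.{u}) = functionalCode e φ) {p : X} (hx : (x : ZFSet.{u}) = e p) :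
    ValMem φN x q ↔ (q : ZFSet.{u}) ∈ realCode (φ p) := by
  unfold ValMem
  rw [hφ, hx]
  simp only [apply_pair_mem_functionalCode]
  constructor
  · rintro ⟨c, hc, hq⟩
    rwa [← hc]
  · intro h
    have h1 : ZFSet.pair (e p) (realCode (φ p)) ∈ (φN : ZFSet.{u}) := by
      rw [hφ, apply_pair_mem_functionalCode]
    exact ⟨⟨_, hereditary_right_of_pair (hereditary_of_mem _ φN.2 _ h1)⟩, rfl, h⟩

theorem tripleValMem_iff {φN x a b k : hereditary θ} {φ : StrongDual ℝ X}
    (hφ : (φN : ZFSet.{u}) = functionalCode e φ) {p : X} (hx : (x : ZFSet.{u}) = e p)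
    {i j l : ℕ} (ha : (a : ZFSet.{u}) = natCode i) (hb : (b : ZFSet.{u}) = natCode j)
    (hk : (k : ZFSet.{u}) = natCode l) :
    TripleValMem φN x a b k ↔ ((i : ℝ) - j) / (l + 1) < φ p := by
  unfold TripleValMem
  rw [hφ, hx, ha, hb, hk]
  simp only [apply_pair_mem_functionalCode]
  rw [← fracCode_mem_realCode.{u}]
  constructor
  · rintro ⟨c, hc, hq⟩
    rwa [← hc]
  · intro h
    have h1 : ZFSet.pair (e p) (realCode (φ p)) ∈ (φN : ZFSet.{u}) := by
      rw [hφ, apply_pair_mem_functionalCode]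
    exact ⟨⟨_, hereditary_right_of_pair (hereditary_of_mem _ φN.2 _ h1)⟩, rfl, h⟩

/-- The elements `DN`, `XN`, `w`, `A` of `H(θ)` represent `D`, `X`, the natural numbers and their
addition, and all sets of pairs of a functional in `D` and a fraction are in `H(θ)`. -/
structure Represents (e : X ↪ ZFSet.{u}) (D : Set (StrongDual ℝ X))
    (DN XN w A : hereditary θ) : Prop where
  dual : (DN : ZFSet.{u}) = dualSetCode e D
  space : (XN : ZFSet.{u}) = ZFSet.range e
  nat : ∀ p : ZFSet.{u}, p ∈ (w : ZFSet.{u}) ↔ ∃ n, p = natCode n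
  add : ∀ (a b : ℕ) (k : hereditary θ),
    ZFSet.pair (ZFSet.pair (natCode a) (natCode b)) (k : ZFSet.{u}) ∈ (A : ZFSet.{u}) ↔
      (k : ZFSet.{u}) = natCode (a + b)
  rel : ZFSet.prod (dualSetCode e D)
    (ZFSet.range fun p : (ℕ × ℕ) × ℕ => fracCode p.1.1 p.1.2 p.2) ∈ hereditary θ

namespace Represents

variable {D : Set (StrongDual ℝ X)} {DN XN w A : hereditary θ} (H : Represents e D DN XN w A)
include H

theorem point_mem (x : X) : e x ∈ hereditary θ :=
  hereditary_of_mem _ XN.2 _ (by rw [H.space, ZFSet.mem_range]; exact ⟨x, rfl⟩)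

theorem mem_space {p : hereditary θ} :
    (p : ZFSet.{u}) ∈ (XN : ZFSet.{u}) ↔ ∃ x, (p : ZFSet.{u}) = e x := by
  rw [H.space, ZFSet.mem_range]
  exact ⟨fun ⟨x, h⟩ => ⟨x, h.symm⟩, fun ⟨x, h⟩ => ⟨x, h.symm⟩⟩

theorem mem_dual {p : hereditary θ} :
    (p : ZFSet.{u}) ∈ (DN : ZFSet.{u}) ↔ ∃ φ ∈ D, (p : ZFSet.{u}) = functionalCode e φ := by
  rw [H.dual, mem_dualSetCode]

theorem functional_mem {φ : StrongDual ℝ X} (hφ : φ ∈ D) : functionalCode e φ ∈ hereditary θ :=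
  hereditary_of_mem _ DN.2 _ (by rwa [H.dual, functionalCode_mem_dualSetCode])

theorem nat_mem (n : ℕ) : natCode n ∈ hereditary θ :=
  hereditary_of_mem _ w.2 _ ((H.nat _).2 ⟨n, rfl⟩)

/-- A norming set separates points, so a sum in `X` is determined by sums of real values, and these
by comparisons with fractions. -/
theorem isSum_iff {r : ℝ} (hr : 0 ≤ r) (hnorm : IsNorming r D) {xN yN zN : hereditary θ}
    {x y z : X} (hx : (xN : ZFSet.{u}) = e x) (hy : (yN : ZFSet.{u}) = e y)
    (hz : (zN : ZFSet.{u}) = e z) : IsSum DN w A xN yN zN ↔ z = x + y := by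
  constructor
  · intro h
    refine hnorm.eq_of_forall hr fun φ hφ => ?_
    rw [map_add, eq_add_iff_frac]
    intro a b a' b' c
    have := h ⟨_, H.functional_mem hφ⟩ ⟨_, H.nat_mem a⟩ ⟨_, H.nat_mem b⟩ ⟨_, H.nat_mem a'⟩
      ⟨_, H.nat_mem b'⟩ ⟨_, H.nat_mem (a + a')⟩ ⟨_, H.nat_mem (b + b')⟩ ⟨_, H.nat_mem c⟩
      (H.mem_dual.2 ⟨φ, hφ, rfl⟩) ((H.nat _).2 ⟨_, rfl⟩) ((H.nat _).2 ⟨_, rfl⟩)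
      ((H.nat _).2 ⟨_, rfl⟩) ((H.nat _).2 ⟨_, rfl⟩) ((H.nat _).2 ⟨_, rfl⟩)
      ((H.add _ _ _).2 rfl) ((H.add _ _ _).2 rfl)
    rwa [tripleValMem_iff (φ := φ) rfl hx rfl rfl rfl, tripleValMem_iff (φ := φ) rfl hy rfl rfl rfl,
      tripleValMem_iff (φ := φ) rfl hz rfl rfl rfl] at this
  · rintro rfl φN aN bN a'N b'N a''N b''N kN hφN haN hbN ha'N hb'N hkN h1 h2
    obtain ⟨φ, hφ, hφN⟩ := H.mem_dual.1 hφN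
    obtain ⟨a, ha⟩ := (H.nat _).1 haN
    obtain ⟨b, hb⟩ := (H.nat _).1 hbN
    obtain ⟨a', ha'⟩ := (H.nat _).1 ha'N
    obtain ⟨b', hb'⟩ := (H.nat _).1 hb'N
    obtain ⟨k, hk⟩ := (H.nat _).1 hkN
    rw [ha, ha', H.add] at h1
    rw [hb, hb', H.add] at h2
    rw [tripleValMem_iff hφN hx ha hb hk, tripleValMem_iff hφN hy ha' hb' hk,
      tripleValMem_iff hφN hz h1 h2 hk]
    exact eq_add_iff_frac.1 (map_add φ x y) a b a' b' k

omit H in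
/-- The intersection of half-spaces described by a set `R` of pairs of a functional and a
fraction. -/
def halfSpaces (e : X ↪ ZFSet.{u}) (D : Set (StrongDual ℝ X)) (R : ZFSet.{u}) : Set X :=
  {d | ∀ φ ∈ D, ∀ a b c : ℕ, ZFSet.pair (functionalCode e φ) (fracCode a b c) ∈ R →
    φ d ≤ ((a : ℝ) - b) / (c + 1)}

omit H in
theorem convex_halfSpaces (R : ZFSet.{u}) : Convex ℝ (halfSpaces e D R) := by
  intro x hx y hy s t hs ht hst φ hφ a b c h
  have h1 := hx φ hφ a b c h
  have h2 := hy φ hφ a b c h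
  rw [map_add, map_smul, map_smul, smul_eq_mul, smul_eq_mul]
  calc s * φ x + t * φ y ≤ s * (((a : ℝ) - b) / (c + 1)) + t * (((a : ℝ) - b) / (c + 1)) := by
        gcongr
    _ = ((a : ℝ) - b) / (c + 1) := by rw [← add_mul, hst, one_mul]

omit H in
theorem isClosed_halfSpaces (R : ZFSet.{u}) : IsClosed (halfSpaces e D R) := by
  have : halfSpaces e D R = ⋂ φ ∈ D, ⋂ (a : ℕ) (b : ℕ) (c : ℕ)
      (_ : ZFSet.pair (functionalCode e φ) (fracCode a b c) ∈ R),
      {d | φ d ≤ ((a : ℝ) - b) / (c + 1)} := by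
    ext d
    simp [halfSpaces]
  rw [this]
  exact isClosed_biInter fun φ _ => isClosed_iInter fun _ => isClosed_iInter fun _ =>
    isClosed_iInter fun _ => isClosed_iInter fun _ =>
      isClosed_le φ.continuous continuous_const

theorem inHalfSpaces_iff {R d : hereditary θ} {x : X} (hx : (d : ZFSet.{u}) = e x) :
    InHalfSpaces DN R d ↔ x ∈ halfSpaces e D R := by
  constructor
  · intro h φ hφ a b c hR
    have hq := hereditary_right_of_pair (hereditary_of_mem _ R.2 _ hR)
    have := h ⟨_, H.functional_mem hφ⟩ ⟨_, hq⟩ (H.mem_dual.2 ⟨φ, hφ, rfl⟩) hR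
    rw [valMem_iff (φ := φ) rfl hx, fracCode_mem_realCode] at this
    exact not_lt.1 this
  · intro h φN q hφN hR hv
    obtain ⟨φ, hφ, hφN⟩ := H.mem_dual.1 hφN
    rw [valMem_iff hφN hx, mem_realCode] at hv
    obtain ⟨a, b, c, hq, hlt⟩ := hv
    rw [hφN, hq] at hR
    exact hlt.not_ge (h φ hφ a b c hR)

/-- Quantifying over all sets `V` closed under halving replaces the iteration: the least such set
containing `x` is the orbit `(1 / 2) ^ n • x`, which belongs to `H(θ)` as a subset of `X`. -/
theorem isAbsorbing_iff {r : ℝ} (hr : 0 ≤ r) (hnorm : IsNorming r D) {R : hereditary θ} :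
    IsAbsorbing DN XN w A R ↔ ∀ x : X, ∃ n : ℕ, (1 / 2 : ℝ) ^ n • x ∈ halfSpaces e D R := by
  have half : ∀ {v h : X}, v = h + h ↔ h = (1 / 2 : ℝ) • v := by
    intro v h
    constructor
    · rintro rfl
      rw [← two_smul ℝ h, smul_smul]
      norm_num
    · rintro rfl
      rw [← add_smul]
      norm_num
  constructor
  · intro h x
    let V : ZFSet.{u} := ZFSet.range fun n : ULift.{u} ℕ => e ((1 / 2 : ℝ) ^ n.down • x)
    have memV : ∀ p, p ∈ V ↔ ∃ n : ℕ, p = e ((1 / 2 : ℝ) ^ n • x) := fun p => by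
      simp only [V, ZFSet.mem_range, ULift.exists]
      exact ⟨fun ⟨n, h⟩ => ⟨n, h.symm⟩, fun ⟨n, h⟩ => ⟨n, h.symm⟩⟩
    have hV : V ∈ hereditary θ := by
      refine hereditary_of_subset (fun p hp => ?_) XN.2
      obtain ⟨n, rfl⟩ := (memV p).1 hp
      rw [H.space, ZFSet.mem_range]
      exact ⟨_, rfl⟩
    obtain ⟨v, hv, hv'⟩ := h ⟨_, H.point_mem x⟩ ⟨V, hV⟩ (H.mem_space.2 ⟨x, rfl⟩)
      ((memV _).2 ⟨0, by simp⟩) (by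
        intro v h hv hh hs
        obtain ⟨n, hn⟩ := (memV _).1 hv
        obtain ⟨y, hy⟩ := H.mem_space.1 hh
        rw [H.isSum_iff hr hnorm hy hy hn, half, smul_smul] at hs
        exact (memV _).2 ⟨n + 1, by rw [hy, hs, pow_succ']⟩)
    obtain ⟨n, hn⟩ := (memV _).1 hv
    exact ⟨n, (H.inHalfSpaces_iff hn).1 hv'⟩
  · intro h x V hx hxV hV
    obtain ⟨p, hp⟩ := H.mem_space.1 hx
    have key : ∀ n : ℕ, e ((1 / 2 : ℝ) ^ n • p) ∈ (V : ZFSet.{u}) := by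
      intro n
      induction n with
      | zero => simpa [← hp] using hxV
      | succ n ih =>
        refine hV ⟨_, H.point_mem _⟩ ⟨_, H.point_mem _⟩ ih (H.mem_space.2 ⟨_, rfl⟩) ?_
        rw [H.isSum_iff hr hnorm rfl rfl rfl, half, smul_smul, pow_succ']
    obtain ⟨n, hn⟩ := h p
    exact ⟨⟨_, H.point_mem _⟩, key n, (H.inHalfSpaces_iff rfl).2 hn⟩

/-- Forwards, `R` is taken to describe `{d | φ d ≤ ε * ‖φ‖ for all φ ∈ D}`. This set contains a
ball, hence absorbs. If both `y - a` and `a - y` lie in it, then `|φ (y - a)| ≤ ε * ‖φ‖` on `D`, and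
norming gives `‖y - a‖ ≤ r * ε`; both signs are needed as `D` need not be symmetric. Backwards, each
absorbing intersection of half-spaces contains a ball, by Baire's theorem. -/
theorem inClosure_iff [CompleteSpace X] {r : ℝ} (hr : 0 ≤ r) (hnorm : IsNorming r D)
    {C yN : hereditary θ} {y : X} (hy : (yN : ZFSet.{u}) = e y) :
    InClosure DN XN w A C yN ↔ y ∈ closure {x | e x ∈ (C : ZFSet.{u})} := by
  constructor
  · intro h
    rw [Metric.mem_closure_iff]
    intro δ hδ
    obtain ⟨ε, hε, hεδ⟩ : ∃ ε > 0, r * ε < δ := by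
      refine ⟨δ / (r + 1), by positivity, ?_⟩
      rw [← mul_div_assoc, div_lt_iff₀ (by positivity)]
      nlinarith
    let R : ZFSet.{u} := ZFSet.sep (fun p => ∃ φ ∈ D, ∃ a b c : ℕ,
      p = ZFSet.pair (functionalCode e φ) (fracCode a b c) ∧
        ε * ‖φ‖ ≤ ((a : ℝ) - b) / (c + 1))
      (ZFSet.prod (dualSetCode e D)
        (ZFSet.range fun p : (ℕ × ℕ) × ℕ => fracCode p.1.1 p.1.2 p.2))
    have hR : R ∈ hereditary θ := hereditary_of_subset ZFSet.sep_subset H.rel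
    have memR : ∀ φ ∈ D, ∀ a b c : ℕ, ZFSet.pair (functionalCode e φ) (fracCode a b c) ∈ R ↔
        ε * ‖φ‖ ≤ ((a : ℝ) - b) / (c + 1) := by
      intro φ hφ a b c
      simp only [R, ZFSet.mem_sep, ZFSet.pair_mem_prod, functionalCode_mem_dualSetCode, hφ,
        true_and]
      constructor
      · rintro ⟨-, ψ, hψ, a', b', c', h, h'⟩
        obtain ⟨h1, h2⟩ := ZFSet.pair_inj.1 h
        obtain ⟨rfl, rfl, rfl⟩ := fracCode_inj.1 h2
        rwa [functionalCode_injective e h1]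
      · intro h
        exact ⟨ZFSet.mem_range.2 ⟨((a, b), c), rfl⟩, φ, hφ, a, b, c, rfl, h⟩
    have hball : ∀ x : X, ‖x‖ ≤ ε → x ∈ halfSpaces e D R := by
      intro x hx φ hφ a b c h
      rw [memR φ hφ] at h
      calc φ x ≤ ‖φ x‖ := Real.le_norm_self _
        _ ≤ ‖φ‖ * ‖x‖ := φ.le_opNorm x
        _ ≤ ‖φ‖ * ε := by gcongr
        _ ≤ _ := by rwa [mul_comm]
    have hle : ∀ x ∈ halfSpaces e D R, ∀ φ ∈ D, φ x ≤ ε * ‖φ‖ := by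
      intro x hx φ hφ
      by_contra! hlt
      obtain ⟨a, b, c, h1, h2⟩ := exists_frac_between hlt
      exact h2.not_ge (hx φ hφ a b c ((memR φ hφ a b c).2 h1.le))
    have habs : IsAbsorbing DN XN w A ⟨R, hR⟩ := by
      rw [H.isAbsorbing_iff hr hnorm]
      intro x
      obtain ⟨n, hn⟩ := exists_pow_lt_of_lt_one (show 0 < ε / (‖x‖ + 1) by positivity)
        (show (1 / 2 : ℝ) < 1 by norm_num)
      refine ⟨n, hball _ ?_⟩
      rw [norm_smul, Real.norm_of_nonneg (by positivity)]
      rw [lt_div_iff₀ (by positivity)] at hn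
      have : (0 : ℝ) ≤ (1 / 2) ^ n := by positivity
      linarith
    obtain ⟨a, d, d', haC, haX, hd, hd', hdR, hdR', hs, hs'⟩ := h _ habs
    obtain ⟨a, ha⟩ := H.mem_space.1 haX
    obtain ⟨d, hd⟩ := H.mem_space.1 hd
    obtain ⟨d', hd'⟩ := H.mem_space.1 hd'
    rw [H.inHalfSpaces_iff hd] at hdR
    rw [H.inHalfSpaces_iff hd'] at hdR'
    rw [H.isSum_iff hr hnorm ha hd hy] at hs
    rw [H.isSum_iff hr hnorm hy hd' ha] at hs'
    refine ⟨a, by rwa [Set.mem_ofPred_eq, ← ha], ?_⟩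
    rw [dist_eq_norm]
    have h1 : d = y - a := by rw [hs]; abel
    have h2 : d' = -(y - a) := by rw [neg_sub]; exact eq_sub_of_add_eq' hs'.symm
    refine (hnorm.norm_le hr hε.le fun φ hφ => abs_le.2 ⟨?_, ?_⟩).trans_lt hεδ
    · have := hle _ hdR' φ hφ
      rw [h2, map_neg] at this
      linarith
    · exact h1 ▸ hle _ hdR φ hφ
  · intro h R hR
    rw [H.isAbsorbing_iff hr hnorm] at hR
    obtain ⟨ε, hε, hball⟩ := (convex_halfSpaces (e := e) (D := D) (R : ZFSet.{u})
      ).exists_ball_subset_of_absorbing (isClosed_halfSpaces _) hR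
    obtain ⟨a, ha, hya⟩ := Metric.mem_closure_iff.1 h ε hε
    refine ⟨⟨_, H.point_mem a⟩, ⟨_, H.point_mem (y - a)⟩, ⟨_, H.point_mem (a - y)⟩, ha,
      H.mem_space.2 ⟨_, rfl⟩, H.mem_space.2 ⟨_, rfl⟩, H.mem_space.2 ⟨_, rfl⟩,
      (H.inHalfSpaces_iff rfl).2 (hball ?_), (H.inHalfSpaces_iff rfl).2 (hball ?_),
      (H.isSum_iff hr hnorm rfl rfl hy).2 (by abel), (H.isSum_iff hr hnorm hy rfl rfl).2 (by abel)⟩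
    · rwa [mem_ball_zero_iff, ← dist_eq_norm]
    · rwa [mem_ball_zero_iff, ← dist_eq_norm, dist_comm]

theorem agreeAt_iff {C xN yN : hereditary θ} {x y : X} (hx : (xN : ZFSet.{u}) = e x)
    (hy : (yN : ZFSet.{u}) = e y) : AgreeAt DN C xN yN ↔
      ∀ φ ∈ D, functionalCode e φ ∈ (C : ZFSet.{u}) → φ x = φ y := by
  constructor
  · intro h φ hφ hC
    refine realCode_injective.{u} (ZFSet.ext fun q => ?_)
    have hreal : ∀ z : X, realCode (φ z) ∈ hereditary θ := fun z =>
      hereditary_right_of_pair (hereditary_of_mem _ (H.functional_mem hφ) _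
        ((apply_pair_mem_functionalCode e (x := z)).2 rfl))
    have key : ∀ hq : q ∈ hereditary θ, q ∈ realCode (φ x) ↔ q ∈ realCode (φ y) := fun hq => by
      have := h ⟨_, H.functional_mem hφ⟩ ⟨q, hq⟩ (H.mem_dual.2 ⟨φ, hφ, rfl⟩) hC
      rwa [valMem_iff (φ := φ) rfl hx, valMem_iff (φ := φ) rfl hy] at this
    exact ⟨fun hq => (key (hereditary_of_mem _ (hreal x) _ hq)).1 hq,
      fun hq => (key (hereditary_of_mem _ (hreal y) _ hq)).2 hq⟩
  · intro h φN q hφN hC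
    obtain ⟨φ, hφ, hφN⟩ := H.mem_dual.1 hφN
    rw [valMem_iff hφN hx, valMem_iff hφN hy, h φ hφ (by rwa [← hφN])]

/-- The clauses of `Decomposes` express, in order: the sum is everything, the intersection is zero,
and the closure is stable under differences and under halving. For a nonempty closed set the last
two already amount to being a subspace. -/
theorem decomposes_of_isCompl [CompleteSpace X] {r : ℝ} (hr : 0 ≤ r) (hnorm : IsNorming r D)
    {C : hereditary θ} {Y : Submodule ℝ X}
    (hY : (Y : Set X) = closure {x | e x ∈ (C : ZFSet.{u})})
    (h : IsCompl Y (leftAnnihilator {φ | φ ∈ D ∧ functionalCode e φ ∈ (C : ZFSet.{u})})) :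
    Decomposes DN XN w A C := by
  have cl : ∀ {yN : hereditary θ} {y : X}, (yN : ZFSet.{u}) = e y →
      (InClosure DN XN w A C yN ↔ y ∈ Y) := fun hy => by
    rw [H.inClosure_iff hr hnorm hy, ← hY, SetLike.mem_coe]
  refine ⟨fun xN hxN => ?_, fun yN zN hyN hzN h1 h2 h3 => ?_,
    fun xN yN zN hxN hyN hzN h1 h2 h3 => ?_, fun xN hN hxN hhN h1 h2 => ?_⟩
  · obtain ⟨x, hx⟩ := H.mem_space.1 hxN
    obtain ⟨y, hy, z, hz, rfl⟩ := Submodule.mem_sup.1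
      (h.sup_eq_top ▸ Submodule.mem_top : x ∈ Y ⊔ leftAnnihilator _)
    refine ⟨⟨_, H.point_mem y⟩, H.mem_space.2 ⟨y, rfl⟩, (cl rfl).2 hy,
      (H.agreeAt_iff hx rfl).2 fun φ hφ hC => ?_⟩
    rw [map_add, hz φ ⟨hφ, hC⟩, add_zero]
  · obtain ⟨y, hy⟩ := H.mem_space.1 hyN
    obtain ⟨z, hz⟩ := H.mem_space.1 hzN
    rw [cl hy] at h1
    rw [cl hz] at h2
    rw [H.agreeAt_iff hy hz] at h3
    have := Submodule.disjoint_def.1 h.disjoint (y - z) (Y.sub_mem h1 h2) fun φ hφ => by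
      rw [map_sub, h3 φ hφ.1 hφ.2, sub_self]
    rw [Subtype.ext_iff, hy, hz, sub_eq_zero.1 this]
  · obtain ⟨x, hx⟩ := H.mem_space.1 hxN
    obtain ⟨y, hy⟩ := H.mem_space.1 hyN
    obtain ⟨z, hz⟩ := H.mem_space.1 hzN
    rw [cl hx] at h1
    rw [cl hy] at h2
    rw [H.isSum_iff hr hnorm hz hy hx] at h3
    rw [cl hz, eq_sub_of_add_eq h3.symm]
    exact Y.sub_mem h1 h2
  · obtain ⟨x, hx⟩ := H.mem_space.1 hxN
    obtain ⟨z, hz⟩ := H.mem_space.1 hhN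
    rw [cl hx] at h1
    rw [H.isSum_iff hr hnorm hz hz hx] at h2
    rw [cl hz]
    have : z = (1 / 2 : ℝ) • x := by
      rw [h2, ← two_smul ℝ z, smul_smul]
      norm_num
    rw [this]
    exact Y.smul_mem _ h1

omit H in
/-- A closed nonempty set closed under subtraction and halving is a linear subspace. -/
theorem _root_.exists_submodule_of_sub_mem_of_half_mem {S : Set X} (hc : IsClosed S)
    (hne : S.Nonempty) (hsub : ∀ x ∈ S, ∀ y ∈ S, x - y ∈ S)
    (hhalf : ∀ x ∈ S, (1 / 2 : ℝ) • x ∈ S) : ∃ Y : Submodule ℝ X, (Y : Set X) = S := by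
  obtain ⟨a, ha⟩ := hne
  have h0 : (0 : X) ∈ S := by simpa using hsub a ha a ha
  have hneg : ∀ x ∈ S, -x ∈ S := fun x hx => by simpa using hsub 0 h0 x hx
  have hadd : ∀ x ∈ S, ∀ y ∈ S, x + y ∈ S := fun x hx y hy => by
    simpa using hsub x hx (-y) (hneg y hy)
  let G : AddSubgroup X :=
    { carrier := S
      add_mem' := fun {x y} hx hy => hadd x hx y hy
      zero_mem' := h0
      neg_mem' := fun {x} hx => hneg x hx }
  have hpow : ∀ (n : ℕ) (x : X), x ∈ S → (1 / 2 : ℝ) ^ n • x ∈ S := by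
    intro n x hx
    induction n with
    | zero => simpa using hx
    | succ n ih =>
      rw [pow_succ', ← smul_smul]
      exact hhalf _ ih
  have hsmul : ∀ (c : ℝ) (x : X), x ∈ S → c • x ∈ S := by
    intro c x hx
    -- Dyadic multiples of `x` lie in `S` by subtraction and halving; real multiples are limits of
    -- these.
    have hlim : Filter.Tendsto (fun n : ℕ => ((⌊c * 2 ^ n⌋ : ℝ) * (1 / 2) ^ n)) Filter.atTop
        (nhds c) := by
      have h1 : Filter.Tendsto (fun n : ℕ => c - (1 / 2 : ℝ) ^ n) Filter.atTop (nhds (c - 0)) :=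
        tendsto_const_nhds.sub (tendsto_pow_atTop_nhds_zero_of_lt_one (by norm_num) (by norm_num))
      rw [sub_zero] at h1
      have e1 : ∀ n : ℕ, c = c * 2 ^ n * (1 / 2) ^ n := fun n => by
        rw [mul_assoc, ← mul_pow]; norm_num
      refine tendsto_of_tendsto_of_tendsto_of_le_of_le h1 tendsto_const_nhds (fun n => ?_)
        (fun n => ?_)
      · have := Int.sub_one_lt_floor (c * 2 ^ n)
        have hp : (0 : ℝ) < (1 / 2) ^ n := by positivity
        have := mul_lt_mul_of_pos_right this hp
        rw [sub_mul, ← e1 n, one_mul] at this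
        exact this.le
      · have hp : (0 : ℝ) < (1 / 2) ^ n := by positivity
        have := mul_le_mul_of_nonneg_right (Int.floor_le (c * 2 ^ n)) hp.le
        rwa [← e1 n] at this
    refine hc.mem_of_tendsto (hlim.smul_const x) (Filter.Eventually.of_forall fun n => ?_)
    rw [← smul_smul, Int.cast_smul_eq_zsmul]
    exact G.zsmul_mem (hpow n x hx) _
  exact ⟨{ carrier := S
           add_mem' := fun {x y} hx hy => hadd x hx y hy
           zero_mem' := h0
           smul_mem' := fun c x hx => hsmul c x hx }, rfl⟩

theorem isCompl_of_decomposes [CompleteSpace X] {r : ℝ} (hr : 0 ≤ r) (hnorm : IsNorming r D)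
    {C : hereditary θ} (h : Decomposes DN XN w A C) :
    ∃ Y : Submodule ℝ X, (Y : Set X) = closure {x | e x ∈ (C : ZFSet.{u})} ∧
      IsCompl Y (leftAnnihilator {φ | φ ∈ D ∧ functionalCode e φ ∈ (C : ZFSet.{u})}) := by
  obtain ⟨h1, h2, h3, h4⟩ := h
  have proj : ∀ x : X, ∃ y ∈ closure {x | e x ∈ (C : ZFSet.{u})},
      ∀ φ ∈ D, functionalCode e φ ∈ (C : ZFSet.{u}) → φ x = φ y := fun x => by
    obtain ⟨yN, hyN, hcl, hag⟩ := h1 ⟨_, H.point_mem x⟩ (H.mem_space.2 ⟨x, rfl⟩)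
    obtain ⟨y, hy⟩ := H.mem_space.1 hyN
    exact ⟨y, (H.inClosure_iff hr hnorm hy).1 hcl, (H.agreeAt_iff rfl hy).1 hag⟩
  obtain ⟨Y, hY⟩ := exists_submodule_of_sub_mem_of_half_mem
    (isClosed_closure (s := {x | e x ∈ (C : ZFSet.{u})}))
    (let ⟨y, hy, _⟩ := proj 0; ⟨y, hy⟩)
    (fun x hx y hy => by
      rw [← H.inClosure_iff hr hnorm (yN := ⟨_, H.point_mem _⟩) rfl] at hx hy ⊢
      exact h3 _ _ _ (H.mem_space.2 ⟨_, rfl⟩) (H.mem_space.2 ⟨_, rfl⟩) (H.mem_space.2 ⟨_, rfl⟩)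
        hx hy ((H.isSum_iff hr hnorm rfl rfl rfl).2 (by abel)))
    (fun x hx => by
      rw [← H.inClosure_iff hr hnorm (yN := ⟨_, H.point_mem _⟩) rfl] at hx ⊢
      refine h4 _ _ (H.mem_space.2 ⟨_, rfl⟩) (H.mem_space.2 ⟨_, rfl⟩)
        hx ((H.isSum_iff hr hnorm rfl rfl rfl).2 ?_)
      rw [← add_smul]
      norm_num)
  refine ⟨Y, hY, ?_, ?_⟩
  · rw [Submodule.disjoint_def]
    intro x hx hx'
    have h0 := Y.zero_mem
    rw [← SetLike.mem_coe, hY] at hx h0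
    rw [← H.inClosure_iff hr hnorm (yN := ⟨_, H.point_mem _⟩) rfl] at hx h0
    have := h2 _ _ (H.mem_space.2 ⟨_, rfl⟩) (H.mem_space.2 ⟨_, rfl⟩) hx h0
      ((H.agreeAt_iff rfl rfl).2 fun φ hφ hC => by rw [hx' φ ⟨hφ, hC⟩, map_zero])
    exact e.injective (Subtype.ext_iff.1 this)
  · rw [codisjoint_iff, eq_top_iff]
    intro x _
    obtain ⟨y, hy, hag⟩ := proj x
    rw [← hY] at hy
    refine Submodule.mem_sup.2 ⟨y, hy, x - y, fun φ hφ => ?_, by abel⟩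
    rw [map_sub, hag φ hφ.1 hφ.2, sub_self]

end Represents

end Interpretation

/-! ### Norming on a subset -/

section Analysis

variable {X : Type u} [NormedAddCommGroup X] [NormedSpace ℝ X]

/-- The functionals in `B` determine the norms of the points of `S` up to the factor `r`. -/
def NormingOn (r : ℝ) (B : Set (StrongDual ℝ X)) (S : Set X) : Prop :=
  ∀ x ∈ S, ∀ ε > 0, ε < ‖x‖ → ∃ φ ∈ B, (‖x‖ - ε) * ‖φ‖ < r * |φ x|

theorem IsNorming.exists_lt {r : ℝ} {D : Set (StrongDual ℝ X)} (hD : IsNorming r D) (hr : 1 ≤ r)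
    {x : X} {ε : ℝ} (hε : 0 < ε) (hx : ε < ‖x‖) : ∃ φ ∈ D, (‖x‖ - ε) * ‖φ‖ < r * |φ x| := by
  by_contra! h
  have hr0 : 0 < r := by linarith
  have := hD.norm_le hr0.le (ε := (‖x‖ - ε) / r) (div_nonneg (by linarith) hr0.le)
    fun φ hφ => by
      rw [div_mul_eq_mul_div, le_div_iff₀ hr0, mul_comm]
      exact h φ hφ
  rw [mul_div_cancel₀ _ hr0.ne'] at this
  linarith

/-- Countably many tolerances suffice, so closure under a sequence of choice functions ensures
norming. -/
theorem NormingOn.of_pow {r : ℝ} {B : Set (StrongDual ℝ X)} {S : Set X}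
    (h : ∀ x ∈ S, ∀ n : ℕ, 1 / ((n : ℝ) + 1) < ‖x‖ →
      ∃ φ ∈ B, (‖x‖ - 1 / ((n : ℝ) + 1)) * ‖φ‖ < r * |φ x|) : NormingOn r B S := by
  intro x hx ε hε hεx
  obtain ⟨n, hn⟩ := exists_nat_one_div_lt hε
  obtain ⟨φ, hφ, hlt⟩ := h x hx n (hn.trans hεx)
  refine ⟨φ, hφ, lt_of_le_of_lt ?_ hlt⟩
  gcongr

/-- Norming passes to the closure with the same factor `r`, which later keeps the projections
bounded by exactly `r`. -/
theorem NormingOn.norm_le {r : ℝ} (hr : 1 ≤ r) {B : Set (StrongDual ℝ X)} {S : Set X}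
    (h : NormingOn r B S) {y : X} (hy : y ∈ closure S) {K : ℝ} (hK : 0 ≤ K)
    (hyK : ∀ φ ∈ B, |φ y| ≤ K * ‖φ‖) : ‖y‖ ≤ r * K := by
  by_contra! hlt
  -- The losses are `δ` from replacing `y` by `a` in the norm, `δ` from the tolerance in
  -- `NormingOn`, and `r * δ` from replacing `y` by `a` in `φ`.
  set δ := (‖y‖ - r * K) / (r + 2) with hδ
  have hδ0 : 0 < δ := div_pos (by linarith) (by linarith)
  have hδy : ‖y‖ = r * K + (r + 2) * δ := by
    rw [hδ, mul_div_cancel₀ _ (by linarith)]; ring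
  obtain ⟨a, ha, hya⟩ := Metric.mem_closure_iff.1 hy δ hδ0
  rw [dist_eq_norm] at hya
  have h1 : ‖y‖ - ‖a‖ ≤ ‖y - a‖ := norm_sub_norm_le y a
  have hrK : 0 ≤ r * K := by positivity
  obtain ⟨φ, hφ, h2⟩ := h a ha δ hδ0 (by nlinarith)
  have h3 : |φ a| ≤ (K + δ) * ‖φ‖ := by
    have h4 : |φ y - φ a| ≤ ‖φ‖ * δ := by
      rw [← map_sub, ← Real.norm_eq_abs]
      exact (φ.le_opNorm _).trans (by gcongr)
    have h5 := abs_sub_abs_le_abs_sub (φ a) (φ y)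
    rw [abs_sub_comm (φ a)] at h5
    linarith [hyK φ hφ]
  have h6 : r * |φ a| ≤ r * (K + δ) * ‖φ‖ := by
    rw [mul_assoc]
    exact mul_le_mul_of_nonneg_left h3 (by linarith)
  have h7 : r * (K + δ) ≤ ‖a‖ - δ := by linarith
  have h8 := mul_le_mul_of_nonneg_right h7 (norm_nonneg φ)
  linarith

/-! ### Limits along directed sets of indices of a projectional skeleton -/

namespace ProjectionalSkeleton

variable {Γ : Type u} [PartialOrder Γ] (s : ProjectionalSkeleton X Γ)

theorem apply_apply_of_le {i j : Γ} (h : i ≤ j) (x : X) : s.P i (s.P j x) = s.P i x :=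
  DFunLike.congr_fun (s.comp_right i j h) x

theorem apply_apply_of_ge {i j : Γ} (h : i ≤ j) (x : X) : s.P j (s.P i x) = s.P i x :=
  DFunLike.congr_fun (s.comp_left i j h) x

theorem range_mono {i j : Γ} (h : i ≤ j) : Set.range (s.P i) ⊆ Set.range (s.P j) := by
  rintro _ ⟨x, rfl⟩
  exact ⟨_, s.apply_apply_of_ge h x⟩

/-- If no index works, there is a strictly increasing sequence `u` along which `P (u n) x` keeps
jumping by `ε`. With `t` its supremum, `P t x` is approximated from the ranges of the `P (u n)`,
which forces `P (u m) x` to come close to `P t x`. -/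
theorem exists_forall_norm_sub_lt {r : ℝ} (hr : 0 ≤ r) (hs : s.BoundedBy r) {T : Set Γ}
    (hne : T.Nonempty) (x : X) {ε : ℝ} (hε : 0 < ε) :
    ∃ i ∈ T, ∀ j ∈ T, i ≤ j → ‖s.P j x - s.P i x‖ < ε := by
  by_contra! hcon
  have hcon' : ∀ i : T, ∃ j : T, i.1 ≤ j.1 ∧ ε ≤ ‖s.P j.1 x - s.P i.1 x‖ := fun i =>
    let ⟨j, hj, h⟩ := hcon i.1 i.2
    ⟨⟨j, hj⟩, h⟩
  choose f hf using hcon'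
  obtain ⟨i₀, hi₀⟩ := hne
  let u : ℕ → Γ := fun n => (f^[n] ⟨i₀, hi₀⟩).1
  have hu : ∀ n, u n ≤ u (n + 1) ∧ ε ≤ ‖s.P (u (n + 1)) x - s.P (u n) x‖ := fun n => by
    simp only [u, Function.iterate_succ_apply']
    exact hf _
  have hmono : StrictMono u := strictMono_nat_of_lt_succ fun n => by
    refine lt_of_le_of_ne (hu n).1 fun h => ?_
    have := (hu n).2
    rw [← h, sub_self, norm_zero] at this
    linarith
  obtain ⟨t, ht, hcl⟩ := s.sup_seq u hmono
  have hz : s.P t x ∈ closure (⋃ n, Set.range (s.P (u n))) := hcl ▸ ⟨x, rfl⟩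
  obtain ⟨z, hz, hdist⟩ := Metric.mem_closure_iff.1 hz (ε / (2 * (r + 1))) (by positivity)
  obtain ⟨n, y, rfl⟩ := Set.mem_iUnion.1 hz
  rw [dist_eq_norm] at hdist
  have key : ∀ m, n ≤ m → ‖s.P (u m) x - s.P t x‖ < ε / 2 := by
    intro m hm
    -- `P (u m)` absorbs `P t` and fixes `P (u n) y`, so the difference is `P (u m) v - v` for a
    -- small `v`, of norm at most `(r + 1) * ‖v‖`.
    have h1 : s.P (u m) x - s.P t x =
        s.P (u m) (s.P t x - s.P (u n) y) - (s.P t x - s.P (u n) y) := by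
      rw [map_sub, s.apply_apply_of_le (ht.1 ⟨m, rfl⟩),
        s.apply_apply_of_ge (hmono.monotone hm)]
      abel
    rw [h1]
    calc _ ≤ ‖s.P (u m) (s.P t x - s.P (u n) y)‖ + ‖s.P t x - s.P (u n) y‖ := norm_sub_le _ _
      _ ≤ r * ‖s.P t x - s.P (u n) y‖ + ‖s.P t x - s.P (u n) y‖ := by
        gcongr
        exact (s.P (u m)).le_of_opNorm_le (hs _) _
      _ = (r + 1) * ‖s.P t x - s.P (u n) y‖ := by ring
      _ < (r + 1) * (ε / (2 * (r + 1))) := by gcongr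
      _ = ε / 2 := by field_simp
  have h1 := key n le_rfl
  have h2 := key (n + 1) n.le_succ
  have h3 := norm_sub_le (s.P (u (n + 1)) x - s.P t x) (s.P (u n) x - s.P t x)
  rw [sub_sub_sub_cancel_right] at h3
  linarith [(hu n).2]

theorem exists_limit [CompleteSpace X] {r : ℝ} (hr : 0 ≤ r) (hs : s.BoundedBy r) {T : Set Γ}
    (hne : T.Nonempty) (hT : DirectedOn (· ≤ ·) T) (x : X) :
    ∃ y ∈ closure (⋃ i ∈ T, Set.range (s.P i)), ∀ ε > 0, ∃ i ∈ T, ∀ j ∈ T, i ≤ j →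
      ‖s.P j x - y‖ < ε := by
  choose u huT hu using fun n : ℕ =>
    s.exists_forall_norm_sub_lt hr hs hne x (Nat.one_div_pos_of_nat (α := ℝ) (n := n))
  have hcauchy : CauchySeq fun n => s.P (u n) x := by
    refine cauchySeq_of_le_tendsto_0 (fun n : ℕ => 2 * (1 / ((n : ℝ) + 1))) ?_ ?_
    · intro m n k hm hn
      -- The indices `u n` need not increase; two of them are compared through a common upper bound
      -- in `T`.
      obtain ⟨j, hj, hmj, hnj⟩ := hT _ (huT m) _ (huT n)
      have h1 := hu m j hj hmj
      have h2 := hu n j hj hnj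
      have h3 := Nat.one_div_le_one_div (α := ℝ) hm
      have h4 := Nat.one_div_le_one_div (α := ℝ) hn
      rw [dist_eq_norm]
      have h5 := norm_sub_le (s.P j x - s.P (u n) x) (s.P j x - s.P (u m) x)
      rw [sub_sub_sub_cancel_left] at h5
      linarith
    · simpa using tendsto_one_div_add_atTop_nhds_zero_nat (𝕜 := ℝ).const_mul 2
  obtain ⟨y, hy⟩ := cauchySeq_tendsto_of_complete hcauchy
  refine ⟨y, mem_closure_of_tendsto hy (Filter.Eventually.of_forall fun n =>
    Set.mem_biUnion (huT n) ⟨x, rfl⟩), fun ε hε => ?_⟩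
  obtain ⟨m, hm⟩ := exists_nat_one_div_lt (half_pos hε)
  obtain ⟨n, hmn, hn⟩ := ((Filter.eventually_ge_atTop m).and
    (Metric.tendsto_nhds.1 hy _ (half_pos hε))).exists
  refine ⟨u n, huT n, fun j hj hij => ?_⟩
  have h1 := hu n j hj hij
  have h2 := Nat.one_div_le_one_div (α := ℝ) hmn
  rw [dist_eq_norm] at hn
  have h3 := norm_add_le (s.P j x - s.P (u n) x) (s.P (u n) x - y)
  rw [sub_add_sub_cancel] at h3
  linarith

/-- The intersection is zero by norming. For the sum, `x` is split as `y + (x - y)` with `y` the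
limit of `P j x`; each `φ ∈ B` has `φ x = φ (P j x)` for all large `j ∈ T`, hence `φ x = φ y`. -/
theorem exists_isCompl [CompleteSpace X] {r : ℝ} (hr : 1 ≤ r) (hs : s.BoundedBy r) {T : Set Γ}
    (hne : T.Nonempty) (hT : DirectedOn (· ≤ ·) T) {S : Set X}
    (hS : closure S = closure (⋃ i ∈ T, Set.range (s.P i))) {B : Set (StrongDual ℝ X)}
    (hB : ∀ φ ∈ B, ∃ i ∈ T, ∀ x, φ (s.P i x) = φ x) (hBS : NormingOn r B S) :
    ∃ Y : Submodule ℝ X, (Y : Set X) = closure S ∧ IsCompl Y (leftAnnihilator B) := by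
  have : Nonempty T := hne.to_subtype
  have hY : (((⨆ i : T, LinearMap.range (s.P i.1 : X →ₗ[ℝ] X)).topologicalClosure :
      Submodule ℝ X) : Set X) = closure S := by
    rw [Submodule.topologicalClosure_coe, Submodule.coe_iSup_of_directed, hS, Set.biUnion_eq_iUnion]
    · rfl
    · rintro ⟨i, hi⟩ ⟨j, hj⟩
      obtain ⟨k, hk, hik, hjk⟩ := hT i hi j hj
      exact ⟨⟨k, hk⟩, s.range_mono hik, s.range_mono hjk⟩
  refine ⟨_, hY, ?_, ?_⟩
  · rw [Submodule.disjoint_def]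
    intro x hx hx'
    rw [← SetLike.mem_coe, hY] at hx
    have := hBS.norm_le hr hx le_rfl fun φ hφ => by simp [hx' φ hφ]
    rwa [mul_zero, norm_le_zero_iff] at this
  · rw [codisjoint_iff, eq_top_iff]
    intro x _
    obtain ⟨y, hy, hlim⟩ := s.exists_limit (by linarith) hs hne hT x
    rw [← hS, ← hY] at hy
    refine Submodule.mem_sup.2 ⟨y, hy, x - y, fun φ hφ => ?_, by abel⟩
    obtain ⟨i, hi, hφi⟩ := hB φ hφ
    rw [map_sub, sub_eq_zero]
    refine eq_of_forall_dist_le fun ε hε => ?_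
    obtain ⟨k, hk, hlim⟩ := hlim (ε / (‖φ‖ + 1)) (by positivity)
    obtain ⟨j, hj, hij, hkj⟩ := hT i hi k hk
    have h1 : φ x = φ (s.P j x) := by
      rw [← hφi (s.P j x), s.apply_apply_of_le hij, hφi]
    rw [h1, dist_eq_norm, ← map_sub]
    calc _ ≤ ‖φ‖ * ‖s.P j x - y‖ := φ.le_opNorm _
      _ ≤ (‖φ‖ + 1) * (ε / (‖φ‖ + 1)) :=
        mul_le_mul (by linarith) (hlim j hj hkj).le (norm_nonneg _) (by positivity)
      _ = ε := by field_simp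

end ProjectionalSkeleton

end Analysis

/-! ### The closing operation given by a projectional skeleton -/

/-- The domain of the closing operation: numbers, points, functionals and indices. -/
inductive Node (X D Γ : Type u) : Type u
  | num : ℕ → Node X D Γ
  | pt : X → Node X D Γ
  | fn : D → Node X D Γ
  | idx : Γ → Node X D Γ

section Step

variable {X : Type u} [NormedAddCommGroup X] [NormedSpace ℝ X] {D : Set (StrongDual ℝ X)}
  {Γ : Type u} (i₀ : Γ) (σ : X → Γ) (τ : D → Γ) (join : Γ → Γ → Γ) (dense : Γ → ℕ → X)
  (ν : ℕ → X → D)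

/-- A binary operation that combines the given operations. -/
def Node.step : Node X D Γ → Node X D Γ → Node X D Γ
  -- From `num 0` alone this row yields all numbers, and the next row then yields `i₀`. A number on
  -- the left of a point or an index selects a member of a sequence of operations; unary operations
  -- are read off from the diagonal.
  | num 0, num m => num (m + 1)
  | num (_ + 1), num _ => idx i₀
  | num n, pt x => fn (ν n x)
  | num n, idx i => pt (dense i n)
  | pt x, pt _ => idx (σ x)
  | fn φ, fn _ => idx (τ φ)
  | idx i, idx j => idx (join i j)
  | _, _ => num 0

variable {i₀ σ τ join dense ν}

theorem Node.num_mem_of_step_mem {C : Set (Node X D Γ)} (h0 : Node.num 0 ∈ C)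
    (h : ∀ a ∈ C, ∀ b ∈ C, Node.step i₀ σ τ join dense ν a b ∈ C) (n : ℕ) : Node.num n ∈ C := by
  induction n with
  | zero => exact h0
  | succ n ih => exact h _ h0 _ ih

/-- A set of nodes closed under the operation obtained from a skeleton gives a decomposition. -/
theorem ProjectionalSkeleton.exists_isCompl_of_step_mem [CompleteSpace X] [PartialOrder Γ]
    (s : ProjectionalSkeleton X Γ) {r : ℝ} (hr : 1 ≤ r) (hs : s.BoundedBy r)
    (hσ : ∀ x, x ∈ Set.range (s.P (σ x))) (hτ : ∀ (φ : D) x, φ.1 (s.P (τ φ) x) = φ.1 x)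
    (hjoin : ∀ i j, i ≤ join i j ∧ j ≤ join i j)
    (hdense : ∀ i, closure (Set.range (dense i)) = closure (Set.range (s.P i)))
    (hν : ∀ (n : ℕ) x, 1 / ((n : ℝ) + 1) < ‖x‖ →
      (‖x‖ - 1 / ((n : ℝ) + 1)) * ‖(ν n x).1‖ < r * |(ν n x).1 x|)
    {C : Set (Node X D Γ)} (h0 : Node.num 0 ∈ C)
    (h : ∀ a ∈ C, ∀ b ∈ C, Node.step i₀ σ τ join dense ν a b ∈ C) :
    ∃ Y : Submodule ℝ X, (Y : Set X) = closure {x | Node.pt x ∈ C} ∧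
      IsCompl Y (leftAnnihilator {φ | ∃ hφ : φ ∈ D, Node.fn ⟨φ, hφ⟩ ∈ C}) := by
  have hnum := Node.num_mem_of_step_mem h0 h
  refine s.exists_isCompl hr hs (T := {i | Node.idx i ∈ C}) ⟨i₀, h _ (hnum 1) _ (hnum 1)⟩
    (fun i hi j hj => ⟨join i j, h _ hi _ hj, hjoin i j⟩) (subset_antisymm ?_ ?_) ?_ ?_
  · refine closure_mono fun x hx => ?_
    exact Set.mem_biUnion (show Node.idx (σ x) ∈ C from h _ hx _ hx) (hσ x)
  · refine closure_minimal (Set.iUnion₂_subset fun i hi => ?_) isClosed_closure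
    refine subset_closure.trans ((hdense i).symm.subset.trans (closure_mono ?_))
    rintro _ ⟨n, rfl⟩
    cases n with
    | zero => exact h _ (hnum 0) _ hi
    | succ n => exact h _ (hnum (n + 1)) _ hi
  · rintro φ ⟨hφ, hC⟩
    exact ⟨_, h _ hC _ hC, hτ ⟨φ, hφ⟩⟩
  · refine NormingOn.of_pow fun x hx n hn => ⟨_, ⟨(ν n x).2, ?_⟩, hν n x hn⟩
    cases n with
    | zero => exact h _ (hnum 0) _ hx
    | succ n => exact h _ (hnum (n + 1)) _ hx

end Step

/-! ### Natural numbers and their addition inside `H(θ)` -/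

section NatAdd

variable {θ : Cardinal.{u}} {w A : hereditary θ}

theorem insert_self_eq_natCode_succ {p : ZFSet.{u}} {n : ℕ} :
    natCode (n + 1) = insert p p ↔ p = natCode n := by
  rw [natCode_succ]
  exact ⟨fun h => (ZFSet.insert_self_injective h).symm, fun h => by rw [h]⟩

theorem natCode_zero_ne_insert (p : ZFSet.{u}) : natCode.{u} 0 ≠ insert p p := by
  rw [natCode_zero]
  intro h
  exact ZFSet.notMem_empty p (h ▸ ZFSet.mem_insert p p)

theorem isNatAdd_of_forall (hw : ∀ p : ZFSet.{u}, p ∈ (w : ZFSet.{u}) ↔ ∃ n, p = natCode n)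
    (hA : ∀ (a b : ℕ) (k : hereditary θ),
      ZFSet.pair (ZFSet.pair (natCode a) (natCode b)) (k : ZFSet.{u}) ∈ (A : ZFSet.{u}) ↔
        (k : ZFSet.{u}) = natCode (a + b)) : IsNatAdd w A := by
  have hmem : ∀ n, natCode n ∈ hereditary θ := fun n =>
    hereditary_of_mem _ w.2 _ ((hw _).2 ⟨n, rfl⟩)
  refine ⟨fun z hz => (hw _).2 ⟨0, by rw [hz, natCode_zero]⟩, fun n t hn ht => ?_, fun n hn => ?_,
    fun n m k hn hm => ?_⟩
  · obtain ⟨i, hi⟩ := (hw _).1 hn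
    exact (hw _).2 ⟨i + 1, by rw [ht, hi, natCode_succ]⟩
  · obtain ⟨i, hi⟩ := (hw _).1 hn
    cases i with
    | zero => exact Or.inl (by rw [hi, natCode_zero])
    | succ i => exact Or.inr ⟨⟨_, hmem i⟩, (hw _).2 ⟨i, rfl⟩, by rw [hi, natCode_succ]⟩
  · obtain ⟨i, hi⟩ := (hw _).1 hn
    obtain ⟨j, hj⟩ := (hw _).1 hm
    rw [hi, hj, hA, Subtype.ext_iff, hi]
    cases j with
    | zero =>
      constructor
      · exact fun h => Or.inl ⟨natCode_zero, h⟩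
      · rintro (⟨-, h⟩ | ⟨m', k', h, -⟩)
        · exact h
        · exact absurd h (natCode_zero_ne_insert _)
    | succ j =>
      constructor
      · intro h
        exact Or.inr ⟨⟨_, hmem j⟩, ⟨_, hmem (i + j)⟩, natCode_succ j, h.trans (natCode_succ _),
          (hA _ _ _).2 rfl⟩
      · rintro (⟨h, -⟩ | ⟨m', k', h, h', h''⟩)
        · exact absurd h (natCode_succ_ne_empty j)
        · rw [insert_self_eq_natCode_succ] at h
          rw [h, hA] at h''
          rw [h', h'', ← add_assoc, natCode_succ]

/-- Nonempty elements of `w` are successors of elements of `w`, so by foundation each one is a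
numeral. -/
theorem IsNatAdd.mem_iff (h : IsNatAdd w A) (hmem : ∀ n, natCode n ∈ hereditary θ)
    (p : ZFSet.{u}) : p ∈ (w : ZFSet.{u}) ↔ ∃ n, p = natCode n := by
  constructor
  · induction p using ZFSet.inductionOn with
    | h p ih =>
      intro hp
      rcases h.2.2.1 ⟨p, hereditary_of_mem _ w.2 _ hp⟩ hp with h0 | ⟨m, hm, hpm⟩
      · exact ⟨0, by rw [natCode_zero]; exact h0⟩
      · change p = _ at hpm
        obtain ⟨n, hn⟩ := ih m (by rw [hpm]; exact ZFSet.mem_insert _ _) hm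
        exact ⟨n + 1, by rw [hpm, hn, natCode_succ]⟩
  · rintro ⟨n, rfl⟩
    induction n with
    | zero => exact h.1 ⟨_, hmem 0⟩ natCode_zero
    | succ n ih => exact h.2.1 ⟨_, hmem n⟩ ⟨_, hmem (n + 1)⟩ ih (natCode_succ n)

theorem IsNatAdd.pair_mem_iff (h : IsNatAdd w A) (hmem : ∀ n, natCode n ∈ hereditary θ)
    (a b : ℕ) (k : hereditary θ) :
    ZFSet.pair (ZFSet.pair (natCode a) (natCode b)) (k : ZFSet.{u}) ∈ (A : ZFSet.{u}) ↔
      (k : ZFSet.{u}) = natCode (a + b) := by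
  have step := fun b k => h.2.2.2 ⟨_, hmem a⟩ ⟨_, hmem b⟩ k ((h.mem_iff hmem _).2 ⟨a, rfl⟩)
    ((h.mem_iff hmem _).2 ⟨b, rfl⟩)
  induction b generalizing k with
  | zero =>
    rw [step 0 k, Subtype.ext_iff]
    constructor
    · rintro (⟨-, h⟩ | ⟨m', k', h, -⟩)
      · exact h
      · exact absurd h (natCode_zero_ne_insert _)
    · exact fun h => Or.inl ⟨natCode_zero, h⟩
  | succ b ih =>
    rw [step (b + 1) k]
    constructor
    · rintro (⟨h, -⟩ | ⟨m', k', h, h', h''⟩)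
      · exact absurd h (natCode_succ_ne_empty b)
      · change natCode (b + 1) = _ at h
        rw [insert_self_eq_natCode_succ] at h
        rw [h] at h''
        rw [h', (ih k').1 h'', ← add_assoc, natCode_succ]
    · intro h
      exact Or.inr ⟨⟨_, hmem b⟩, ⟨_, hmem (a + b)⟩, natCode_succ b, h.trans (natCode_succ _),
        (ih _).2 rfl⟩

end NatAdd

/-! ### Codes of nodes -/

section NodeCode

variable {X : Type u} [NormedAddCommGroup X] [NormedSpace ℝ X] {D : Set (StrongDual ℝ X)}
  {Γ : Type u} (e : X ↪ ZFSet.{u})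

theorem ZFSet.pair_notMem_left (x y : ZFSet.{u}) : ZFSet.pair x y ∉ x := by
  intro h
  have h1 := ZFSet.rank_lt_of_mem h
  have h2 := ZFSet.rank_lt_of_mem (ZFSet.singleton_mem_pair x y)
  have h3 := ZFSet.rank_lt_of_mem (ZFSet.mem_singleton.2 (rfl : x = x))
  exact (h3.trans (h2.trans h1)).false

/-- Points may be arbitrary sets, so disjointness comes from foundation: a functional is defined at
every point, hence its code has greater rank than each point. -/
theorem point_ne_functionalCode (x : X) (φ : StrongDual ℝ X) : e x ≠ functionalCode e φ := by
  intro h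
  have h1 := ZFSet.rank_lt_of_mem ((apply_pair_mem_functionalCode e (φ := φ) (x := x)).2 rfl)
  have h2 := ZFSet.rank_lt_of_mem (ZFSet.singleton_mem_pair (e x) (realCode (φ x)))
  have h3 := ZFSet.rank_lt_of_mem (ZFSet.mem_singleton.2 (rfl : e x = e x))
  rw [← h] at h1
  exact (h3.trans (h2.trans h1)).false

theorem exists_embedding_zfset (α : Type u) : Nonempty (α ↪ ZFSet.{u}) :=
  ⟨⟨fun a => (embeddingToCardinal a).ord.toZFSet, fun _ _ h => embeddingToCardinal.injective
    (Cardinal.ord_injective (Ordinal.toZFSet_injective h))⟩⟩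

/-- Nodes can be coded by sets so that points and functionals have their own codes. -/
theorem exists_nodeCode (D : Set (StrongDual ℝ X)) (Γ : Type u) :
    ∃ c : Node X D Γ ↪ ZFSet.{u}, (∀ x, c (.pt x) = e x) ∧
      ∀ φ : D, c (.fn φ) = functionalCode e φ.1 := by
  obtain ⟨g⟩ := exists_embedding_zfset (Node X D Γ)
  -- A pair with first component `S` cannot be an element of `S`, so this tag keeps numbers and
  -- indices apart from points and functionals.
  let S : ZFSet.{u} := ZFSet.range e ∪ dualSetCode e D
  have hS : ∀ (x : X) y, ZFSet.pair S y ≠ e x := fun x y h =>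
    ZFSet.pair_notMem_left S y (h ▸ ZFSet.mem_union.2 (Or.inl (ZFSet.mem_range_self x)))
  have hS' : ∀ (φ : D) y, ZFSet.pair S y ≠ functionalCode e φ.1 := fun φ y h =>
    ZFSet.pair_notMem_left S y
      (h ▸ ZFSet.mem_union.2 (Or.inr ((functionalCode_mem_dualSetCode e).2 φ.2)))
  let c : Node X D Γ → ZFSet.{u}
    | .pt x => e x
    | .fn φ => functionalCode e φ.1
    | .num n => ZFSet.pair S (g (.num n))
    | .idx i => ZFSet.pair S (g (.idx i))
  have hc : Function.Injective c := by
    intro a b h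
    cases a <;> cases b <;> simp only [c] at h
    · exact g.injective (ZFSet.pair_inj.1 h).2
    · exact absurd h (hS _ _)
    · exact absurd h (hS' _ _)
    · exact g.injective (ZFSet.pair_inj.1 h).2
    · exact absurd h.symm (hS _ _)
    · rw [e.injective h]
    · exact absurd h (point_ne_functionalCode e _ _)
    · exact absurd h.symm (hS _ _)
    · exact absurd h.symm (hS' _ _)
    · exact absurd h.symm (point_ne_functionalCode e _ _)
    · rw [Subtype.ext (functionalCode_injective e h)]
    · exact absurd h.symm (hS' _ _)
    · exact g.injective (ZFSet.pair_inj.1 h).2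
    · exact absurd h (hS _ _)
    · exact absurd h (hS' _ _)
    · exact g.injective (ZFSet.pair_inj.1 h).2
  exact ⟨⟨c, hc⟩, fun _ => rfl, fun _ => rfl⟩

end NodeCode

/-! ### A projectional skeleton gives generated projections -/

section Generates

variable {X : Type u} [NormedAddCommGroup X] [NormedSpace ℝ X] {D : Set (StrongDual ℝ X)}

/-- An operation on nodes that always produces decompositions. -/
def IsDecomposingStep {Γ : Type u} (D : Set (StrongDual ℝ X))
    (F : Node X D Γ → Node X D Γ → Node X D Γ) : Prop :=
  ∀ C : Set (Node X D Γ), Node.num 0 ∈ C → (∀ a ∈ C, ∀ b ∈ C, F a b ∈ C) →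
    ∃ Y : Submodule ℝ X, (Y : Set X) = closure {x | Node.pt x ∈ C} ∧
      IsCompl Y (leftAnnihilator {φ | ∃ hφ : φ ∈ D, Node.fn ⟨φ, hφ⟩ ∈ C})

theorem ProjectionalSkeleton.exists_isDecomposingStep [CompleteSpace X] {Γ : Type u}
    [PartialOrder Γ] (s : ProjectionalSkeleton X Γ) {r : ℝ} (hr : 1 ≤ r) (hs : s.BoundedBy r)
    (hD : D.Nonempty) (hnorm : IsNorming r D) (hDs : D ⊆ s.dualSpace) :
    ∃ F : Node X D Γ → Node X D Γ → Node X D Γ, IsDecomposingStep D F := by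
  have hσ : ∀ x : X, ∃ i, x ∈ Set.range (s.P i) := fun x =>
    Set.mem_iUnion.1 (s.cover ▸ Set.mem_univ x)
  have hτ : ∀ φ : D, ∃ i, ∀ x, φ.1 (s.P i x) = φ.1 x := by
    rintro ⟨φ, hφ⟩
    obtain ⟨i, ψ, rfl⟩ := Set.mem_iUnion.1 (hDs hφ)
    exact ⟨i, fun x => congrArg ψ (s.apply_apply_of_le le_rfl x)⟩
  have hdense : ∀ i, ∃ d : ℕ → X, closure (Set.range d) = closure (Set.range (s.P i)) := by
    intro i
    have : TopologicalSpace.SeparableSpace (Set.range (s.P i)) := (s.separable i).separableSpace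
    have : Nonempty (Set.range (s.P i)) := ⟨⟨_, 0, rfl⟩⟩
    refine ⟨fun n => (TopologicalSpace.denseSeq (Set.range (s.P i)) n).1, ?_⟩
    refine subset_antisymm (closure_mono ?_) (closure_minimal ?_ isClosed_closure)
    · rintro _ ⟨n, rfl⟩
      exact (TopologicalSpace.denseSeq (Set.range (s.P i)) n).2
    · intro x hx
      have := TopologicalSpace.denseRange_denseSeq (Set.range (s.P i)) ⟨x, hx⟩
      rw [closure_subtype, ← Set.range_comp] at this
      exact this
  have hν : ∀ (n : ℕ) (x : X), ∃ φ : D, 1 / ((n : ℝ) + 1) < ‖x‖ →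
      (‖x‖ - 1 / ((n : ℝ) + 1)) * ‖φ.1‖ < r * |φ.1 x| := by
    intro n x
    by_cases h : 1 / ((n : ℝ) + 1) < ‖x‖
    · obtain ⟨φ, hφ, hlt⟩ := hnorm.exists_lt hr Nat.one_div_pos_of_nat h
      exact ⟨⟨φ, hφ⟩, fun _ => hlt⟩
    · exact ⟨⟨_, hD.some_mem⟩, fun h' => absurd h' h⟩
  choose σ hσ using hσ
  choose τ hτ using hτ
  choose dense hdense using hdense
  choose ν hν using hν
  choose join hjoin using s.directed
  exact ⟨Node.step (σ 0) σ τ join dense ν, fun C h0 h =>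
    s.exists_isCompl_of_step_mem hr hs hσ hτ hjoin hdense hν h0 h⟩

theorem IsDecomposingStep.exists_isDecomposingOperation [CompleteSpace X] {Γ : Type u}
    {F : Node X D Γ → Node X D Γ → Node X D Γ} (hF : IsDecomposingStep D F)
    (e : X ↪ ZFSet.{u}) {r : ℝ} (hr : 0 ≤ r) (hnorm : IsNorming r D) (hD : D.Nonempty) :
    ∃ θ₀ : Cardinal.{u}, ∀ θ, θ₀ ≤ θ → ∀ DN : hereditary θ, (DN : ZFSet.{u}) = dualSetCode e D →
      (∀ n, natCode n ∈ hereditary θ) ∧ (ZFSet.prod (dualSetCode e D)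
        (ZFSet.range fun p : (ℕ × ℕ) × ℕ => fracCode p.1.1 p.1.2 p.2) ∈ hereditary θ) ∧
      ∃ XN w A Z E z : hereditary θ, IsDecomposingOperation DN XN w A Z E z := by
  obtain ⟨c, hcx, hcφ⟩ := exists_nodeCode e D Γ
  let XN : ZFSet.{u} := ZFSet.range e
  let w : ZFSet.{u} := ZFSet.range natCode.{u}
  let A : ZFSet.{u} := ZFSet.range fun p : ℕ × ℕ =>
    ZFSet.pair (ZFSet.pair (natCode p.1) (natCode p.2)) (natCode (p.1 + p.2))
  let Z : ZFSet.{u} := ZFSet.range c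
  let E : ZFSet.{u} := ZFSet.range fun p : Node X D Γ × Node X D Γ =>
    ZFSet.pair (ZFSet.pair (c p.1) (c p.2)) (c (F p.1 p.2))
  let R : ZFSet.{u} := ZFSet.prod (dualSetCode e D)
    (ZFSet.range fun p : (ℕ × ℕ) × ℕ => fracCode p.1.1 p.1.2 p.2)
  -- `H(θ)` is transitive, so it suffices to capture one set that has all the needed sets as
  -- elements.
  obtain ⟨θ₀, hθ₀⟩ := exists_forall_mem_hereditary ({XN, w, A, Z, E, R} : ZFSet.{u})
  refine ⟨θ₀, fun θ hθ DN hDN => ?_⟩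
  have hmem : ∀ p ∈ ({XN, w, A, Z, E, R} : ZFSet.{u}), p ∈ hereditary θ :=
    hereditary_of_mem _ (hθ₀ θ hθ)
  have hXN := hmem XN (by simp)
  have hw := hmem w (by simp)
  have hA := hmem A (by simp)
  have hZ := hmem Z (by simp)
  have hE := hmem E (by simp)
  have hR := hmem R (by simp)
  have hcZ : ∀ a, c a ∈ Z := fun a => ZFSet.mem_range_self a
  have hcH : ∀ a, c a ∈ hereditary θ := fun a => hereditary_of_mem _ hZ _ (hcZ a)
  have hnat : ∀ n, natCode n ∈ w := fun n => ZFSet.mem_range.2 ⟨n, rfl⟩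
  have H : Represents e D DN ⟨XN, hXN⟩ ⟨w, hw⟩ ⟨A, hA⟩ :=
    { dual := hDN
      space := rfl
      nat := fun p => by
        simp only [w, ZFSet.mem_range]
        exact ⟨fun ⟨n, h⟩ => ⟨n, h.symm⟩, fun ⟨n, h⟩ => ⟨n, h.symm⟩⟩
      add := fun a b k => by
        simp only [A, ZFSet.mem_range, ZFSet.pair_inj, Prod.exists]
        constructor
        · rintro ⟨i, j, ⟨h1, h2⟩, h3⟩
          rw [← h3, natCode_injective h1, natCode_injective h2]
        · exact fun h => ⟨a, b, ⟨rfl, rfl⟩, h.symm⟩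
      rel := hR }
  have hEF : ∀ a b p, ZFSet.pair (ZFSet.pair (c a) (c b)) p ∈ E ↔ p = c (F a b) := by
    intro a b p
    simp only [E, ZFSet.mem_range, ZFSet.pair_inj, Prod.exists]
    constructor
    · rintro ⟨i, j, ⟨h1, h2⟩, h3⟩
      rw [← h3, c.injective h1, c.injective h2]
    · exact fun h => ⟨a, b, ⟨rfl, rfl⟩, h.symm⟩
  refine ⟨fun n => hereditary_of_mem _ hw _ (hnat n), hR, ⟨XN, hXN⟩, ⟨w, hw⟩, ⟨A, hA⟩, ⟨Z, hZ⟩,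
    ⟨E, hE⟩, ⟨_, hcH (.num 0)⟩, ?_, isNatAdd_of_forall H.nat H.add, ?_, ?_, hcZ _, ?_, ?_⟩
  · intro x
    rw [H.mem_space]
    constructor
    · rintro ⟨p, hp⟩
      -- Some functional is needed for `X` to be visible as a domain.
      obtain ⟨φ, hφ⟩ := hD
      have hφH := H.functional_mem hφ
      have h1 := (apply_pair_mem_functionalCode e (φ := φ) (x := p)).2 rfl
      exact ⟨⟨_, hφH⟩, ⟨_, hereditary_right_of_pair (hereditary_of_mem _ hφH _ h1)⟩,
        H.mem_dual.2 ⟨φ, hφ, rfl⟩, by rw [hp]; exact h1⟩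
    · rintro ⟨φN, k, hφN, h⟩
      obtain ⟨φ, -, hφ⟩ := H.mem_dual.1 hφN
      rw [hφ, pair_mem_functionalCode] at h
      obtain ⟨p, hp, -⟩ := h
      exact ⟨p, hp⟩
  · intro x hx
    obtain ⟨p, hp⟩ := H.mem_space.1 hx
    rw [hp, ← hcx]
    exact hcZ _
  · intro x hx
    obtain ⟨φ, hφ, hp⟩ := H.mem_dual.1 hx
    rw [hp, ← hcφ ⟨φ, hφ⟩]
    exact hcZ _
  · intro p q hp hq
    obtain ⟨a, ha⟩ := ZFSet.mem_range.1 hp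
    obtain ⟨b, hb⟩ := ZFSet.mem_range.1 hq
    exact ⟨⟨_, hcH (F a b)⟩, hcZ _, by rw [← ha, ← hb]; exact (hEF _ _ _).2 rfl⟩
  · intro C hC h0 hcl
    obtain ⟨Y, hY, hcompl⟩ := hF {a | c a ∈ (C : ZFSet.{u})} h0 fun a ha b hb => by
      obtain ⟨k, hk, hkE⟩ := hcl ⟨_, hcH a⟩ ⟨_, hcH b⟩ ha hb
      rw [hEF] at hkE
      rwa [Set.mem_ofPred_eq, ← hkE]
    refine H.decomposes_of_isCompl hr hnorm (Y := Y) ?_ ?_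
    · simpa only [Set.mem_ofPred_eq, hcx] using hY
    · simpa only [Set.mem_ofPred_eq, hcφ, exists_prop] using hcompl

theorem IsDecomposingStep.generatesProjections [CompleteSpace X] {Γ : Type u}
    {F : Node X D Γ → Node X D Γ → Node X D Γ} (hF : IsDecomposingStep D F)
    (e : X ↪ ZFSet.{u}) {r : ℝ} (hr : 0 ≤ r) (hnorm : IsNorming r D) (hD : D.Nonempty) :
    GeneratesProjections e D := by
  obtain ⟨θ₀, hθ₀⟩ := hF.exists_isDecomposingOperation e hr hnorm hD
  refine ⟨θ₀, fun θ hθ _ M _ hM => ?_⟩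
  obtain ⟨DN, hDM, hDN⟩ := hM
  obtain ⟨hnat, hrel, hex⟩ := hθ₀ θ hθ DN hDN
  -- These witnesses come from elementarity and need not be the ones constructed from the skeleton;
  -- that they represent `X` and the arithmetic is deduced below from the formula.
  obtain ⟨XN, w, A, Z, E, z, hZ, hE, hz, hop⟩ :=
    exists_isDecomposingOperation_mem hereditary_of_mem M hDM hex
  obtain ⟨hX, hNat, hXZ, hDZ, hzZ, hclZ, hdec⟩ := hop
  have hdual : ∀ φ ∈ D, functionalCode e φ ∈ hereditary θ := fun φ hφ =>
    hereditary_of_mem _ DN.2 _ (by rwa [hDN, functionalCode_mem_dualSetCode])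
  have H : Represents e D DN XN w A :=
    { dual := hDN
      space := by
        ext p
        rw [ZFSet.mem_range]
        constructor
        · intro hp
          obtain ⟨φN, k, hφN, h⟩ := (hX ⟨p, hereditary_of_mem _ XN.2 _ hp⟩).1 hp
          rw [hDN, mem_dualSetCode] at hφN
          obtain ⟨φ, -, hφ⟩ := hφN
          rw [hφ, pair_mem_functionalCode] at h
          obtain ⟨x, hx, -⟩ := h
          exact ⟨x, hx.symm⟩
        · rintro ⟨x, rfl⟩
          obtain ⟨φ, hφ⟩ := hD
          have h1 := (apply_pair_mem_functionalCode e (φ := φ) (x := x)).2 rfl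
          have h2 := hereditary_of_mem _ (hdual φ hφ) _ h1
          exact (hX ⟨e x, hereditary_left_of_pair h2⟩).2 ⟨⟨_, hdual φ hφ⟩,
            ⟨_, hereditary_right_of_pair h2⟩,
            by rw [hDN]; exact (functionalCode_mem_dualSetCode e).2 hφ, h1⟩
      nat := hNat.mem_iff hnat
      add := hNat.pair_mem_iff hnat
      rel := hrel }
  -- `Z ∩ M` need not be an element of `M`, but it is in `H(θ)`, over which the last clause of
  -- `IsDecomposingOperation` quantifies.
  let C : hereditary θ := ⟨ZFSet.sep (· ∈ elements M) (Z : ZFSet.{u}),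
    hereditary_of_subset ZFSet.sep_subset Z.2⟩
  have hmem : ∀ x : hereditary θ, (x : ZFSet.{u}) ∈ elements M ↔ x ∈ M := fun x =>
    ⟨fun ⟨y, hy, h⟩ => Subtype.ext h ▸ hy, fun h => ⟨x, h, rfl⟩⟩
  have hC : ∀ x : hereditary θ, (x : ZFSet.{u}) ∈ (C : ZFSet.{u}) ↔
      (x : ZFSet.{u}) ∈ (Z : ZFSet.{u}) ∧ x ∈ M := fun x => by
    rw [← hmem]
    exact ZFSet.mem_sep
  obtain ⟨Y, hY, hcompl⟩ := H.isCompl_of_decomposes hr hnorm (hdec C (fun x hx => ((hC x).1 hx).1)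
    ((hC z).2 ⟨hzZ, hz⟩) (hclZ.of_elementary hereditary_of_mem M hZ hE hC))
  have hpt : ∀ x : X, e x ∈ (C : ZFSet.{u}) ↔ e x ∈ elements M := fun x => by
    rw [hC ⟨_, H.point_mem x⟩, ← hmem ⟨_, H.point_mem x⟩]
    exact and_iff_right (hXZ ⟨_, H.point_mem x⟩ (H.mem_space.2 ⟨x, rfl⟩))
  have hfn : ∀ φ, φ ∈ D ∧ functionalCode e φ ∈ (C : ZFSet.{u}) ↔
      φ ∈ D ∧ functionalCode e φ ∈ elements M := fun φ => and_congr_right fun hφ => by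
    rw [hC ⟨_, hdual φ hφ⟩, ← hmem ⟨_, hdual φ hφ⟩]
    exact and_iff_right (hDZ ⟨_, hdual φ hφ⟩ (H.mem_dual.2 ⟨φ, hφ, rfl⟩))
  simp only [hpt] at hY
  simp only [hfn] at hcompl
  exact ⟨Y, hY, hcompl⟩

end Generates

/-! ### Projectional skeletons from families of decompositions -/

section Family

variable {X : Type u} [NormedAddCommGroup X] [NormedSpace ℝ X]

/-- The bounded projection given by a decomposition. -/
theorem exists_projection {r : ℝ} (hr : 1 ≤ r) {S : Set X} {B : Set (StrongDual ℝ X)}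
    {Y : Submodule ℝ X} (hY : (Y : Set X) = closure S) (h : IsCompl Y (leftAnnihilator B))
    (hBS : NormingOn r B S) : ∃ P : X →L[ℝ] X, ‖P‖ ≤ r ∧ Set.range P = closure S ∧
      (∀ x ∈ closure S, P x = x) ∧ (∀ x, ∀ φ ∈ B, φ (P x) = φ x) ∧
      ∀ x, (∀ φ ∈ B, φ x = 0) → P x = 0 := by
  let P₀ : X →ₗ[ℝ] X := Y.projection (leftAnnihilator B) h
  have hmem : ∀ x, P₀ x ∈ closure S := fun x => by
    rw [← hY]
    exact Submodule.projection_apply_mem h x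
  have hφ : ∀ x, ∀ φ ∈ B, φ (P₀ x) = φ x := fun x φ hφ => by
    have : φ (x - P₀ x) = 0 := Submodule.sub_projection_mem h x φ hφ
    rw [map_sub, sub_eq_zero] at this
    exact this.symm
  have hid : ∀ x ∈ closure S, P₀ x = x := fun x hx =>
    Submodule.projection_apply_of_mem_left h (by rwa [← SetLike.mem_coe, hY])
  -- `φ (P₀ x) = φ x` for `φ ∈ B`, and `B` norms the closure of `S`, where `P₀ x` lies.
  have hbound : ∀ x, ‖P₀ x‖ ≤ r * ‖x‖ := fun x =>
    hBS.norm_le hr (hmem x) (norm_nonneg x) fun φ hφB => by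
      rw [hφ x φ hφB, ← Real.norm_eq_abs, mul_comm]
      exact φ.le_opNorm x
  refine ⟨P₀.mkContinuous r hbound, P₀.mkContinuous_norm_le (by linarith) hbound, ?_, hid, hφ,
    fun x hx => (Submodule.projection_apply_eq_zero_iff h).2 hx⟩
  exact subset_antisymm (Set.range_subset_iff.2 hmem) fun x hx => ⟨x, hid x hx⟩

/-- Ranges increase with `S` and kernels decrease as `B` increases, which gives the two composition
rules. Functionals in `B i` are fixed by the adjoint of `P i`, so they lie in the induced subspace.
-/
theorem exists_skeleton_of_family {r : ℝ} (hr : 1 ≤ r) {D : Set (StrongDual ℝ X)} {Γ : Type u}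
    [PartialOrder Γ] (S : Γ → Set X) (B : Γ → Set (StrongDual ℝ X)) (hS : Monotone S)
    (hB : Monotone B) (hcount : ∀ i, (S i).Countable)
    (hdec : ∀ i, ∃ Y : Submodule ℝ X, (Y : Set X) = closure (S i) ∧
      IsCompl Y (leftAnnihilator (B i)))
    (hBS : ∀ i, NormingOn r (B i) (S i)) (hcover : ∀ x, ∃ i, x ∈ S i)
    (hD : ∀ φ ∈ D, ∃ i, φ ∈ B i) (hdir : ∀ i j : Γ, ∃ k, i ≤ k ∧ j ≤ k)
    (hsup : ∀ u : ℕ → Γ, StrictMono u → ∃ t, IsLUB (Set.range u) t ∧ S t = ⋃ n, S (u n)) :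
    ∃ s : ProjectionalSkeleton X Γ, s.BoundedBy r ∧ D ⊆ s.dualSpace := by
  choose Y hY hcompl using hdec
  choose P hPr hPrange hPid hPφ hPker using fun i => exists_projection hr (hY i) (hcompl i) (hBS i)
  have hPmem : ∀ i x, P i x ∈ closure (S i) := fun i x => hPrange i ▸ ⟨x, rfl⟩
  refine ⟨⟨P, fun i => ?_, hdir, ?_, fun i => ?_, fun i j hij => ?_, fun i j hij => ?_,
    fun u hu => ?_⟩, hPr, fun φ hφ => ?_⟩
  · ext x
    exact hPid i _ (hPmem i x)
  · refine Set.eq_univ_of_forall fun x => ?_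
    obtain ⟨i, hi⟩ := hcover x
    exact Set.mem_iUnion.2 ⟨i, x, hPid i x (subset_closure hi)⟩
  · rw [hPrange]
    exact (hcount i).isSeparable.closure
  · ext x
    have := hPker i (P j x - x) fun φ hφ => by
      rw [map_sub, hPφ j x φ (hB hij hφ), sub_self]
    rwa [map_sub, sub_eq_zero] at this
  · ext x
    exact hPid j _ (closure_mono (hS hij) (hPmem i x))
  · obtain ⟨t, ht, hSt⟩ := hsup u hu
    refine ⟨t, ht, ?_⟩
    simp only [hPrange, hSt]
    refine subset_antisymm (closure_mono (Set.iUnion_mono fun n => subset_closure))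
      (closure_minimal (Set.iUnion_subset fun n => ?_) isClosed_closure)
    exact closure_mono (Set.subset_iUnion (fun n => S (u n)) n)
  · obtain ⟨i, hi⟩ := hD φ hφ
    refine Set.mem_iUnion.2 ⟨i, φ, ?_⟩
    ext x
    exact hPφ i x φ hi

end Family

/-! ### Countable elementary substructures -/

section Elementary

variable {N : Set ZFSet.{u}}

/-- The union of an increasing sequence of elementary substructures is elementary. -/
theorem exists_elementarySubstructure_iUnion (u : ℕ → setLanguage.ElementarySubstructure N)
    (hu : Monotone fun n => (u n : Set N)) :
    ∃ M : setLanguage.ElementarySubstructure N, (M : Set N) = ⋃ n, (u n : Set N) := by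
  let S : setLanguage.Substructure N := ⟨⋃ n, (u n : Set N), fun f => Empty.elim f⟩
  refine ⟨⟨S, S.isElementary_of_exists fun n φ x a h => ?_⟩, rfl⟩
  have hx : ∀ i, ∃ k, (x i : N) ∈ u k := fun i => Set.mem_iUnion.1 (x i).2
  choose k hk using hx
  -- Tarski–Vaught test: the finitely many parameters of a formula lie in a single member of the
  -- chain, which then supplies the witness.
  have hK : ∀ i, (x i : N) ∈ u (Finset.univ.sup k) := fun i =>
    hu (Finset.le_sup (Finset.mem_univ i)) (hk i)
  obtain ⟨b, hb, hφ⟩ := DefinablePred.exists_mem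
    (P := fun v b => φ.Realize default (Fin.snoc v b : Fin (n + 1) → N))
    ⟨φ, fun v => by
      have : Fin.snoc (fun i => v i.castSucc) (v (Fin.last n)) = v := Fin.snoc_init_self v
      change _ ↔ φ.Realize default (Fin.snoc (fun i => v i.castSucc) (v (Fin.last n)))
      rw [this]⟩ (u (Finset.univ.sup k)) (Subtype.val ∘ x) hK ⟨a, h⟩
  exact ⟨⟨b, Set.mem_iUnion.2 ⟨_, hb⟩⟩, hφ⟩

theorem exists_countable_elementarySubstructure [Infinite N] {s : Set N} (hs : s.Countable) :
    ∃ M : setLanguage.ElementarySubstructure N, (M : Set N).Countable ∧ s ⊆ M := by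
  have hlang : setLanguage.card ≤ Cardinal.aleph0 := by
    have h0 : ∀ l, Countable (setLanguage.Functions l) := fun _ =>
      inferInstanceAs (Countable Empty)
    have h1 : ∀ l, Countable (setLanguage.Relations l) := fun l => by
      have : Subsingleton (SetTheoryRel l) := ⟨fun a b => by cases a; cases b; rfl⟩
      exact inferInstanceAs (Countable (SetTheoryRel l))
    exact Cardinal.mk_le_aleph0_iff.2
      (inferInstanceAs (Countable ((Σ l, setLanguage.Functions l) ⊕ Σ l, setLanguage.Relations l)))
  obtain ⟨M, hsM, hM⟩ := exists_elementarySubstructure_card_eq setLanguage s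
    (Cardinal.aleph0.{u + 1}) le_rfl (by simpa using hs)
    (by simpa using hlang) (by simp)
  refine ⟨M, ?_, hsM⟩
  rw [Cardinal.lift_id, Cardinal.lift_id] at hM
  exact Cardinal.mk_le_aleph0_iff.1 hM.le

/-- Löwenheim–Skolem hulls alternate with adding values of the `g n`; the union of the resulting
chain is closed under both. -/
theorem exists_countable_elementarySubstructure_closed [Infinite N] (g : ℕ → N → N) {s : Set N}
    (hs : s.Countable) : ∃ M : setLanguage.ElementarySubstructure N, (M : Set N).Countable ∧
      s ⊆ M ∧ ∀ n, ∀ p ∈ M, g n p ∈ M := by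
  choose f hf hsf using fun t : {t : Set N // t.Countable} =>
    exists_countable_elementarySubstructure t.2
  let next : {t : Set N // t.Countable} → {t : Set N // t.Countable} := fun t =>
    ⟨(f t : Set N) ∪ ⋃ n, g n '' (f t : Set N),
      (hf t).union (Set.countable_iUnion fun n => (hf t).image _)⟩
  let u : ℕ → setLanguage.ElementarySubstructure N := fun n => f (next^[n] ⟨s, hs⟩)
  have hstep : ∀ n, (u n : Set N) ∪ ⋃ k, g k '' (u n : Set N) ⊆ u (n + 1) := fun n => by
    simp only [u, Function.iterate_succ_apply']
    exact hsf (next _)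
  obtain ⟨M, hM⟩ := exists_elementarySubstructure_iUnion u
    (monotone_nat_of_le_succ fun n => Set.subset_union_left.trans (hstep n))
  refine ⟨M, ?_, ?_, fun n p hp => ?_⟩
  · rw [hM]
    exact Set.countable_iUnion fun n => hf _
  · rw [hM]
    exact (hsf ⟨s, hs⟩).trans (Set.subset_iUnion (fun n => (u n : Set N)) 0)
  · rw [← SetLike.mem_coe, hM] at hp ⊢
    obtain ⟨k, hk⟩ := Set.mem_iUnion.1 hp
    exact Set.mem_iUnion.2 ⟨k + 1, hstep k (Or.inr (Set.mem_iUnion.2 ⟨n, p, hk, rfl⟩))⟩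

theorem exists_mem_transClosure_rank_eq (x : ZFSet.{u}) {o : Ordinal.{u}} (ho : o < x.rank) :
    ∃ y ∈ transClosure x, y.rank = o := by
  induction x using ZFSet.inductionOn with
  | h x ih =>
    obtain ⟨y, hy, hle⟩ := ZFSet.lt_rank_iff.1 ho
    rcases hle.eq_or_lt with h | h
    · exact ⟨y, .single hy, h.symm⟩
    · obtain ⟨z, hz, h⟩ := ih y hy h
      exact ⟨z, transClosure_subset_of_mem hy hz, h⟩

/-- All ordinals below `x.rank` are ranks of elements of the transitive closure of `x`. Hence
`x.rank` has cardinality below `θ`, and `H(θ)` lies in a von Neumann stage. -/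
theorem small_hereditary (θ : Cardinal.{u}) : Small.{u} (hereditary θ) := by
  have h : hereditary θ ⊆ ((ZFSet.vonNeumann θ.ord : ZFSet.{u}) : Set ZFSet.{u}) := by
    intro x hx
    refine ZFSet.mem_vonNeumann.2 (Cardinal.lt_ord.2 ?_)
    have h1 : Set.Iio x.rank ⊆ ZFSet.rank '' transClosure x := fun o ho => by
      obtain ⟨y, hy, h⟩ := exists_mem_transClosure_rank_eq x ho
      exact ⟨y, hy, h⟩
    have h2 := (Cardinal.mk_le_mk_of_subset h1).trans Cardinal.mk_image_le
    rw [Cardinal.mk_Iio_ordinal] at h2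
    exact Cardinal.lift_lt.1 (h2.trans_lt hx)
  have : Small.{u} ((ZFSet.vonNeumann θ.ord : ZFSet.{u}) : Set ZFSet.{u}) := ZFSet.small_coe _
  exact small_subset h

end Elementary

/-! ### Generated projections give a projectional skeleton -/

section Skeleton

variable {X : Type u} [NormedAddCommGroup X] [NormedSpace ℝ X] {D : Set (StrongDual ℝ X)}

theorem GeneratesProjections.exists_skeleton {e : X ↪ ZFSet.{u}} (h : GeneratesProjections e D)
    {r : ℝ} (hr : 1 ≤ r) (hnorm : IsNorming r D) :
    ∃ (Γ : Type u) (_ : PartialOrder Γ) (s : ProjectionalSkeleton X Γ),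
      s.BoundedBy r ∧ D ⊆ s.dualSpace := by
  obtain ⟨θ₀, hθ₀⟩ := h
  obtain ⟨θ₁, hθ₁⟩ := exists_forall_mem_hereditary
    ({dualSetCode e D, ZFSet.range e, ZFSet.range natCode.{u}} : ZFSet.{u})
  let κ := max Cardinal.aleph0 (max θ₀ θ₁)
  let θ := Order.succ κ
  have hκθ : κ ≤ θ := Order.le_succ κ
  have hreg : θ.IsRegular := Cardinal.isRegular_succ (le_max_left _ _)
  have hH := hθ₁ θ (((le_max_right _ _).trans (le_max_right _ _)).trans hκθ)
  replace hθ₀ := hθ₀ θ (((le_max_left _ _).trans (le_max_right _ _)).trans hκθ) hreg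
  have hdual : dualSetCode e D ∈ hereditary θ := hereditary_of_mem _ hH _ (by simp)
  have hpt : ∀ x, e x ∈ hereditary θ := fun x =>
    hereditary_of_mem _ (hereditary_of_mem _ hH (ZFSet.range e) (by simp)) _
      (ZFSet.mem_range_self x)
  have hnat : ∀ n, natCode n ∈ hereditary θ := fun n =>
    hereditary_of_mem _ (hereditary_of_mem _ hH (ZFSet.range natCode.{u}) (by simp)) _
      (ZFSet.mem_range.2 ⟨n, rfl⟩)
  have hfn : ∀ φ ∈ D, functionalCode e φ ∈ hereditary θ := fun φ hφ =>
    hereditary_of_mem _ hdual _ ((functionalCode_mem_dualSetCode e).2 hφ)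
  have : Infinite (hereditary θ) := Infinite.of_injective (fun n => ⟨natCode n, hnat n⟩)
    fun m n hmn => natCode_injective (Subtype.ext_iff.1 hmn)
  -- The norm of `X` need not be definable from `D`, so `M` may miss almost norming functionals for
  -- its points; closure under the choice functions `g n` supplies them.
  have hν : ∀ (n : ℕ) (p : hereditary θ), ∃ q : hereditary θ, ∀ x, (p : ZFSet.{u}) = e x →
      1 / ((n : ℝ) + 1) < ‖x‖ → ∃ φ ∈ D, (q : ZFSet.{u}) = functionalCode e φ ∧
        (‖x‖ - 1 / ((n : ℝ) + 1)) * ‖φ‖ < r * |φ x| := by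
    intro n p
    by_cases hp : ∃ x, (p : ZFSet.{u}) = e x ∧ 1 / ((n : ℝ) + 1) < ‖x‖
    · obtain ⟨x, hx, hlt⟩ := hp
      obtain ⟨φ, hφ, hφx⟩ := hnorm.exists_lt hr Nat.one_div_pos_of_nat hlt
      refine ⟨⟨_, hfn φ hφ⟩, fun y hy _ => ⟨φ, hφ, rfl, ?_⟩⟩
      rwa [← e.injective (hx.symm.trans hy)]
    · exact ⟨p, fun x hx hlt => absurd ⟨x, hx, hlt⟩ hp⟩
  choose g hg using hν
  let G := {M : setLanguage.ElementarySubstructure (hereditary θ) //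
    (M : Set (hereditary θ)).Countable ∧ (⟨_, hdual⟩ : hereditary θ) ∈ M ∧ ∀ n, ∀ p ∈ M, g n p ∈ M}
  -- The index set has to live in the universe of `X`, whereas `H(θ)` is a collection of sets one
  -- universe higher.
  have hsmall : Small.{u} G := by
    have := small_hereditary θ
    exact small_of_injective (β := Set (hereditary θ))
      (f := fun M : G => (M.1 : Set (hereditary θ)))
      fun M M' hMM => Subtype.ext (SetLike.coe_injective hMM)
  let ι : Shrink.{u} G ≃ G := (equivShrink G).symm
  let _ : PartialOrder (Shrink.{u} G) := PartialOrder.lift ι ι.injective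
  let carrier : Shrink.{u} G → Set (hereditary θ) := fun i => ((ι i).1 : Set (hereditary θ))
  have hle : ∀ i j, i ≤ j ↔ carrier i ⊆ carrier j := fun i j => Iff.rfl
  have hmem : ∀ i (p : hereditary θ), (p : ZFSet.{u}) ∈ elements (ι i).1 ↔ p ∈ carrier i :=
    fun i p => ⟨fun ⟨q, hq, hqp⟩ => Subtype.ext hqp ▸ hq, fun hp => ⟨p, hp, rfl⟩⟩
  have hex : ∀ a : Set (hereditary θ), a.Countable → ∃ i, a ⊆ carrier i := by
    intro a ha
    obtain ⟨M, hM, haM, hgM⟩ := exists_countable_elementarySubstructure_closed g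
      (ha.insert (⟨_, hdual⟩ : hereditary θ))
    refine ⟨ι.symm ⟨M, hM, haM (Set.mem_insert _ _), hgM⟩, ?_⟩
    simp only [carrier, Equiv.apply_symm_apply]
    exact (Set.subset_insert _ _).trans haM
  refine ⟨Shrink.{u} G, inferInstance, exists_skeleton_of_family hr
    (fun i => {x | e x ∈ elements (ι i).1})
    (fun i => {φ | φ ∈ D ∧ functionalCode e φ ∈ elements (ι i).1}) ?_ ?_ ?_ ?_ ?_ ?_ ?_ ?_ ?_⟩
  · exact fun i j hij x hx => Set.image_mono ((hle i j).1 hij) hx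
  · exact fun i j hij φ hφ => ⟨hφ.1, Set.image_mono ((hle i j).1 hij) hφ.2⟩
  · exact fun i => ((ι i).2.1.image Subtype.val).preimage e.injective
  · exact fun i => hθ₀ (ι i).1 (ι i).2.1 ⟨_, (ι i).2.2.1, rfl⟩
  · refine fun i => NormingOn.of_pow fun x hx n hn => ?_
    obtain ⟨φ, hφ, hq, hlt⟩ := hg n ⟨e x, hpt x⟩ x rfl hn
    refine ⟨φ, ⟨hφ, ?_⟩, hlt⟩
    rw [← hq, hmem]
    exact (ι i).2.2.2 n _ ((hmem i _).1 hx)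
  · intro x
    obtain ⟨i, hi⟩ := hex {⟨e x, hpt x⟩} (Set.countable_singleton _)
    exact ⟨i, (hmem i ⟨e x, hpt x⟩).2 (hi rfl)⟩
  · intro φ hφ
    obtain ⟨i, hi⟩ := hex {⟨_, hfn φ hφ⟩} (Set.countable_singleton _)
    exact ⟨i, hφ, (hmem i ⟨_, hfn φ hφ⟩).2 (hi rfl)⟩
  · intro i j
    obtain ⟨k, hk⟩ := hex (carrier i ∪ carrier j) ((ι i).2.1.union (ι j).2.1)
    exact ⟨k, Set.subset_union_left.trans hk, Set.subset_union_right.trans hk⟩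
  · intro u hu
    -- The union of the chain is again an index, hence its supremum for inclusion.
    obtain ⟨M, hM⟩ := exists_elementarySubstructure_iUnion (fun n => (ι (u n)).1)
      fun m n hmn => (hle _ _).1 (hu.monotone hmn)
    have hMG : (M : Set (hereditary θ)).Countable ∧ (⟨_, hdual⟩ : hereditary θ) ∈ M ∧
        ∀ n, ∀ p ∈ M, g n p ∈ M := by
      simp only [← SetLike.mem_coe, hM]
      refine ⟨Set.countable_iUnion fun n => (ι (u n)).2.1,
        Set.mem_iUnion.2 ⟨0, (ι (u 0)).2.2.1⟩, fun n p hp => ?_⟩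
      obtain ⟨k, hk⟩ := Set.mem_iUnion.1 hp
      exact Set.mem_iUnion.2 ⟨k, (ι (u k)).2.2.2 n p hk⟩
    let t : Shrink.{u} G := ι.symm ⟨M, hMG⟩
    have ht : carrier t = ⋃ n, carrier (u n) := by
      simp only [carrier, t, Equiv.apply_symm_apply, hM]
    refine ⟨t, ⟨?_, fun j hj => ?_⟩, ?_⟩
    · rintro _ ⟨n, rfl⟩
      rw [hle, ht]
      exact Set.subset_iUnion (fun n => carrier (u n)) n
    · rw [hle, ht]
      exact Set.iUnion_subset fun n => (hle _ _).1 (hj ⟨n, rfl⟩)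
    · ext x
      simp only [Set.mem_iUnion, Set.mem_ofPred_eq, hmem _ ⟨e x, hpt x⟩, ht]

end Skeleton

theorem mainTheorem3 {X : Type u} [NormedAddCommGroup X] [NormedSpace ℝ X] [CompleteSpace X]
    (e : X ↪ ZFSet.{u}) (r : ℝ) (hr : 1 ≤ r) (D : Set (StrongDual ℝ X)) (hD : D.Nonempty)
    (hnorm : IsNorming r D) :
    (∃ (Γ : Type u) (_ : PartialOrder Γ) (s : ProjectionalSkeleton X Γ),
        s.BoundedBy r ∧ D ⊆ s.dualSpace) ↔
      GeneratesProjections e D := by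
  constructor
  · rintro ⟨Γ, _, s, hs, hDs⟩
    obtain ⟨F, hF⟩ := s.exists_isDecomposingStep hr hs hD hnorm hDs
    exact hF.generatesProjections e (zero_le_one.trans hr) hnorm hD
  · exact fun h => h.exists_skeleton hr hnorm
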